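/- An alternating automaton on finite words (AFA) consists of a finite nonempty alphabet $\Sigma$, a finite set $Q$ of states, an initial state $\iota\in Q$, a set $F\subseteq Q$ of accepting states and a transition function $\delta\colon Q\times\Sigma\to\mathcal B^+(Q)$, where $\mathcal B^+(Q)$ is the set of positive Boolean formulas over $Q$ (built from states with $\wedge$ and $\vee$). Starting in $\iota$, when a letter $a$ is read in state $q$ the players descend in the formula $\delta(q,a)$, Eve choosing a disjunct at each disjunction and Adam a conjunct at each conjunction, until a state is reached, in which the next letter is read. The AFA $\mathcal A$ accepts a word $w\in\Sigma^*$, written $w\in L(\mathcal A)$, if Eve has a strategy (possibly depending on all of $w$) such that every play over $w$ that agrees with it ends in a state of $F$. In Eve's letter game the letters are chosen one by one by Adam, who chooses each letter when the play is in a state and may also stop the game in any state; Eve wins a stopped play if the word $w$ formed by the chosen letters satisfies $w\notin L(\mathcal A)$ or the state reached is in $F$. (A play that is never stopped is not lost by Eve.) The AFA $\mathcal A$ is $\exists\mathrm{GFG}$ if Eve has a winning strategy (a function of the history of the play) in her letter game. Lemma. The problem of deciding, given an AFA $\mathcal A$, whether $\mathcal A$ is $\exists\mathrm{GFG}$ is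 PSPACE-hard under polynomial-time many-one reductions: for every language $L$ in PSPACE over a finite alphabet $I$ there is a polynomial-time computable function that maps each word $x\in I^*$ to (the encoding of) an AFA $\mathcal A_x$ such that $x\in L$ if and only if $\mathcal A_x$ is $\exists\mathrm{GFG}$. -/

import Mathlib

/-! ### Alternating automata on finite words -/

/-- Positive Boolean formulas over `Q` (no negation, no constants). -/
inductive PosFormula (Q : Type) : Type
  | atom (q : Q) : PosFormula Q
  | and (φ ψ : PosFormula Q) : PosFormula Q
  | or (φ ψ : PosFormula Q) : PosFormula Q

/-- An alternating automaton on finite words (AFA) with alphabet `α` and state set `Q`. -/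
structure AFA (α Q : Type) where
  /-- the initial state -/
  init : Q
  /-- the transition conditions -/
  δ : Q → α → PosFormula Q
  /-- the accepting (final) states -/
  final : Finset Q

namespace AFA

variable {α Q : Type}

/-- A move made in a play: either a letter is read, or in the one-step arena the left (`false`) or
the right (`true`) subformula of a conjunction or disjunction is chosen. -/
abbrev Move (α : Type) : Type := α ⊕ Bool

/-- A strategy of Eve, for resolving disjunctions: it maps the whole history of the play (which
determines the current position) to the choice of the left or the right disjunct. -/
abbrev Strategy (α : Type) : Type := List (Move α) → Bool

/-- `A.Play σ h w φ`: there is a play of history `h` that starts in the initial state, agrees with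
Eve's strategy `σ`, in which the word `w` has been read, and whose current position is `φ`.
In a state (that is, at an atom) the next letter is read, and the play enters the transition
condition; at a conjunction Adam chooses a conjunct; at a disjunction Eve chooses a disjunct. -/
inductive Play (A : AFA α Q) (σ : Strategy α) :
    List (Move α) → List α → PosFormula Q → Prop
  | start : Play A σ [] [] (.atom A.init)
  | letter {h : List (Move α)} {w : List α} {q : Q} (a : α) :
      Play A σ h w (.atom q) → Play A σ (h ++ [.inl a]) (w ++ [a]) (A.δ q a)
  | adam {h : List (Move α)} {w : List α} {φ ψ : PosFormula Q} (b : Bool) :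
      Play A σ h w (.and φ ψ) → Play A σ (h ++ [.inr b]) w (bif b then ψ else φ)
  | eve {h : List (Move α)} {w : List α} {φ ψ : PosFormula Q} :
      Play A σ h w (.or φ ψ) → Play A σ (h ++ [.inr (σ h)]) w (bif σ h then ψ else φ)

/-- `σ` wins the model-checking game on the word `w`: every play that agrees with `σ` and reads
exactly the word `w` ends in an accepting state. -/
def WinsModelChecking (A : AFA α Q) (σ : Strategy α) (w : List α) : Prop :=
  ∀ (h : List (Move α)) (q : Q), A.Play σ h w (.atom q) → q ∈ A.final

/-- The language of `A`: the words on which Eve wins the model-checking game. The strategy may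
depend on the whole word. -/
def language (A : AFA α Q) : Language α :=
  {w | ∃ σ : Strategy α, A.WinsModelChecking σ w}

/-- `σ` wins Eve's letter game. Here Adam chooses the letters one by one, and may stop in any
state. Eve wins the finished play if the generated word is not in the language or the reached state
is accepting. -/
def WinsLetterGame (A : AFA α Q) (σ : Strategy α) : Prop :=
  ∀ (h : List (Move α)) (w : List α) (q : Q), A.Play σ h w (.atom q) →
    w ∉ A.language ∨ q ∈ A.final

/-- `A` is `∃GFG`: Eve wins her letter game. -/
def IsExistsGFG (A : AFA α Q) : Prop :=
  ∃ σ : Strategy α, A.WinsLetterGame σ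

end AFA

/-! ### AFAs as inputs of a decision problem -/

/-- An AFA given explicitly: the alphabet is `{0, …, numLetters - 1}`, the set of states is
`{0, …, numStates - 1}` (nonempty since it contains the initial state). -/
structure AFAInstance where
  /-- the number of letters -/
  numLetters : ℕ
  /-- the alphabet is nonempty -/
  letters_pos : 0 < numLetters
  /-- the number of states -/
  numStates : ℕ
  /-- the automaton -/
  aut : AFA (Fin numLetters) (Fin numStates)

/-- The finite alphabet in which AFAs are written down. -/
inductive AFASymbol : Type
  | tick
  | sep
  | conj
  | disj
  | yes
  | no
  deriving DecidableEq

instance : Fintype AFASymbol where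
  elems := {.tick, .sep, .conj, .disj, .yes, .no}
  complete s := by cases s <;> decide

namespace AFAInstance

open AFASymbol

/-- Numbers (names of states, numbers of letters and states) in unary: `n` ticks and a separator. -/
def encodeNumber (n : ℕ) : List AFASymbol := List.replicate n tick ++ [sep]

/-- Formulas in prefix notation. -/
def encodeFormula {n : ℕ} : PosFormula (Fin n) → List AFASymbol
  | .atom q => encodeNumber q
  | .and φ ψ => conj :: (encodeFormula φ ++ encodeFormula ψ)
  | .or φ ψ => disj :: (encodeFormula φ ++ encodeFormula ψ)

/-- An AFA is written as: number of letters, number of states, initial state, for each state whether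
it is accepting, and then the transition conditions `δ(q, a)`, for each state `q` and letter `a`.
The length of this word is polynomial in the size of the AFA (the maximum of the number of
letters, the number of states, and the total length of the transition conditions), and vice versa. -/
def encode (A : AFAInstance) : List AFASymbol :=
  encodeNumber A.numLetters ++ (encodeNumber A.numStates ++ (encodeNumber A.aut.init ++
    ((List.finRange A.numStates).flatMap (fun q => if q ∈ A.aut.final then [yes] else [no]) ++
      (List.finRange A.numStates).flatMap fun q =>
        (List.finRange A.numLetters).flatMap fun a => encodeFormula (A.aut.δ q a))))

theorem encodeNumber_append {m n : ℕ} {r s : List AFASymbol}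
    (h : encodeNumber m ++ r = encodeNumber n ++ s) : m = n ∧ r = s := by
  induction m generalizing n with
  | zero => cases n <;> simp_all [encodeNumber, List.replicate_succ]
  | succ m ih =>
    cases n with
    | zero => simp [encodeNumber, List.replicate_succ] at h
    | succ n =>
      have := @ih n (by simpa [encodeNumber, List.replicate_succ] using h)
      exact ⟨by rw [this.1], this.2⟩

theorem encodeFormula_append {n : ℕ} {φ ψ : PosFormula (Fin n)} {r s : List AFASymbol}
    (h : encodeFormula φ ++ r = encodeFormula ψ ++ s) : φ = ψ ∧ r = s := by
  have aux : ∀ (k : ℕ) (c : AFASymbol) (t u : List AFASymbol), (c = conj ∨ c = disj) →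
      encodeNumber k ++ t ≠ c :: u := by
    intro k c t u hc
    cases k <;> rcases hc with rfl | rfl <;> simp [encodeNumber, List.replicate_succ]
  induction φ generalizing ψ r s with
  | atom q =>
    cases ψ with
    | atom q' =>
      obtain ⟨h1, h2⟩ := encodeNumber_append h
      exact ⟨by rw [Fin.ext h1], h2⟩
    | and a b => exact absurd h (aux _ _ _ _ (Or.inl rfl))
    | or a b => exact absurd h (aux _ _ _ _ (Or.inr rfl))
  | and a b iha ihb =>
    cases ψ with
    | atom q => exact absurd h.symm (aux _ _ _ _ (Or.inl rfl))
    | and c d =>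
      simp only [encodeFormula, List.cons_append, List.append_assoc, List.cons.injEq,
        true_and] at h
      obtain ⟨h1, h2⟩ := iha h
      obtain ⟨h3, h4⟩ := ihb h2
      exact ⟨by rw [h1, h3], h4⟩
    | or c d => simp [encodeFormula] at h
  | or a b iha ihb =>
    cases ψ with
    | atom q => exact absurd h.symm (aux _ _ _ _ (Or.inr rfl))
    | or c d =>
      simp only [encodeFormula, List.cons_append, List.append_assoc, List.cons.injEq,
        true_and] at h
      obtain ⟨h1, h2⟩ := iha h
      obtain ⟨h3, h4⟩ := ihb h2
      exact ⟨by rw [h1, h3], h4⟩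
    | and c d => simp [encodeFormula] at h

theorem flatMap_append {ι β : Type} (f g : ι → List β) (R : ι → Prop)
    (hR : ∀ i r s, f i ++ r = g i ++ s → R i ∧ r = s) (l : List ι) (r s : List β)
    (h : l.flatMap f ++ r = l.flatMap g ++ s) : (∀ i ∈ l, R i) ∧ r = s := by
  induction l with
  | nil => simpa using h
  | cons i l ih =>
    simp only [List.flatMap_cons, List.append_assoc] at h
    obtain ⟨h1, h2⟩ := hR i _ _ h
    obtain ⟨h3, h4⟩ := ih h2
    exact ⟨by simpa using ⟨h1, h3⟩, h4⟩

theorem encode_injective : Function.Injective encode := by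
  rintro ⟨k, hk, m, ⟨i, d, F⟩⟩ ⟨k', hk', m', ⟨i', d', F'⟩⟩ h
  obtain ⟨rfl, h⟩ := encodeNumber_append h
  obtain ⟨rfl, h⟩ := encodeNumber_append h
  obtain ⟨hi, h⟩ := encodeNumber_append h
  obtain rfl := Fin.ext hi
  obtain ⟨hF, h⟩ := flatMap_append _ _ (fun q => q ∈ F ↔ q ∈ F') (by
    intro q r s hq
    by_cases h1 : q ∈ F <;> by_cases h2 : q ∈ F' <;> simp_all) _ _ _ h
  obtain rfl : F = F' := Finset.ext fun q => hF q (List.mem_finRange q)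
  obtain ⟨hd, -⟩ := flatMap_append _ _ (fun q => ∀ a, d q a = d' q a) (by
    intro q r s hq
    obtain ⟨h1, h2⟩ := flatMap_append _ _ (fun a => d q a = d' q a)
      (fun a r s ha => encodeFormula_append ha) _ _ _ hq
    exact ⟨fun a => h1 a (List.mem_finRange a), h2⟩) _ [] [] (by simpa using h)
  obtain rfl : d = d' := by
    funext q a
    exact hd q (List.mem_finRange q) a
  rfl

/-- `encode` as an encoding in the sense of Mathlib (it can be decoded uniquely). -/
noncomputable def encoding : Computability.Encoding AFAInstance AFASymbol where
  encode := encode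
  decode := Function.partialInv encode
  decode_encode A := Function.partialInv_left encode_injective A

end AFAInstance

/-! ### Polynomial space, polynomial time, and hardness -/

open Turing in
/-- The displacement of the head in the next step of a one-tape Turing machine. -/
def headMove {Γ Λ : Type} [Inhabited Γ] [Inhabited Λ] (M : TM0.Machine Γ Λ) (c : TM0.Cfg Γ Λ) : ℤ :=
  match M c.q c.Tape.head with
  | some (_, .move .left) => -1
  | some (_, .move .right) => 1
  | _ => 0

/-- `HeadReaches M c₀ c z`: started in the configuration `c₀` with the head at cell `0`, the one-tape
machine `M` reaches the configuration `c` with the head at cell `z` (of the two-way infinite tape). -/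
inductive HeadReaches {Γ Λ : Type} [Inhabited Γ] [Inhabited Λ] (M : Turing.TM0.Machine Γ Λ)
    (c₀ : Turing.TM0.Cfg Γ Λ) : Turing.TM0.Cfg Γ Λ → ℤ → Prop
  | refl : HeadReaches M c₀ c₀ 0
  | step {c c' : Turing.TM0.Cfg Γ Λ} {z : ℤ} :
      HeadReaches M c₀ c z → c' ∈ Turing.TM0.step M c → HeadReaches M c₀ c' (z + headMove M c)

open Turing in
/-- `L` is in PSPACE: it is decided by a deterministic one-tape Turing machine `M` with finitely
many tape symbols and states and a set `acc` of accepting states, in polynomial space. The input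
alphabet is embedded in the nonblank tape symbols; on every input `x` the machine halts, it does so
in an accepting state if and only if `x ∈ L`, and its head never goes further than `p(|x|)` cells
from where it started. -/
def InPSPACE {I : Type} (L : Language I) : Prop :=
  ∃ (Γ Λ : Type) (_ : Inhabited Γ) (_ : Inhabited Λ) (_ : Finite Γ) (_ : Finite Λ)
    (M : TM0.Machine Γ Λ) (acc : Set Λ) (e : I ↪ Γ) (p : Polynomial ℕ),
    (∀ i, e i ≠ default) ∧
    ∀ x : List I,
      (∃ c : TM0.Cfg Γ Λ, TM0.Reaches M (TM0.init (x.map e)) c ∧ TM0.step M c = none ∧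
        (c.q ∈ acc ↔ x ∈ L)) ∧
      ∀ (c : TM0.Cfg Γ Λ) (z : ℤ), HeadReaches M (TM0.init (x.map e)) c z →
        z.natAbs ≤ p.eval x.length

/-- `f` is computed in polynomial time by a deterministic multi-stack (equivalently, multi-tape)
Turing machine with finite alphabets. -/
def PolyTimeComputable {α β αΓ βΓ : Type} (ea : α → List αΓ) (eb : β → List βΓ) (f : α → β) :
    Prop :=
  ∃ c : Turing.TM2ComputableInPolyTime ea eb f, ∀ k, Finite (c.tm.Γ k)

/-- The decision problem "given `a : α`, encoded by `enc`, does `P a` hold?" is PSPACE-hard: every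
language in PSPACE, over any finite alphabet, is many-one reducible to it in polynomial time. -/
def IsPSPACEHard {α αΓ : Type} (enc : Computability.Encoding α αΓ) (P : α → Prop) : Prop :=
  ∀ (I : Type) [Finite I] (L : Language I), InPSPACE L →
    ∃ f : List I → α, PolyTimeComputable (fun x : List I => x) enc.encode f ∧
      ∀ x : List I, x ∈ L ↔ P (f x)

/-! The reduction uses automata over a single letter. A polynomial-space machine is simulated by a
cellular automaton on a row of polynomial length, in which "the machine has halted and rejects" is a
cell content that, once present, stays forever (`InPSPACE.exists_cellAutomaton`). Alternation traces
such a row back in time: a state for the pair of a cell and a content guesses (Eve) the three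
neighbouring contents one step earlier and has each of them checked (Adam). With `t` letters left to
read, it accepts exactly when the cell has this content at time `t`
(`CellAutomaton.acceptsAt_cell`).

On the first letter the initial state goes to a conjunction. One conjunct claims that some cell now
has a rejecting content; the other makes Eve guess the parity of the number of remaining letters. A
guess made with the whole word known is always right, so the second conjunct does not affect the
language (`CellAutomaton.accepts_init_iff`). If `x ∈ L`, the language is empty and Eve wins her
letter game trivially. If `x ∉ L`, all long enough words are accepted, by stability of the rejecting
content; Adam picks the parity conjunct and stops after one of two consecutive long lengths,
whichever refutes the guess. This is `CellAutomaton.isExistsGFG_automaton_iff`.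

For the time bound, the cellular automaton depends only on the machine and not on `x`. The encoding
of the alternating automaton is therefore the concatenation of the expansions of four fixed
templates along the padded input row (`CellAutomaton.encode_toAFA`). A small language of
push-and-loop programs, compiled to multi-stack machines (`StackProg.Exec.iterate`), produces the
row and expands templates in polynomial time (`RowTemplate.polyTimeComputable`). -/

/-! ### Structured programs for multi-stack machines -/

/-- Structured programs acting on stacks indexed by `K`. Each stack has a register, which holds the
symbol that the enclosing loop over this stack has popped last. -/
inductive StackProg (K : Type) (Γ : K → Type) : Type
  | skip : StackProg K Γ
  | push (k : K) (f : (∀ k, Option (Γ k)) → Γ k) : StackProg K Γ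
  | seq (p q : StackProg K Γ) : StackProg K Γ
  | loop (k : K) (p : StackProg K Γ) : StackProg K Γ

namespace StackProg

open Function Turing

variable {K : Type} {Γ : K → Type}

/-- The labels of the machine that runs a program. -/
def Label : StackProg K Γ → Type
  | skip => Unit
  | push _ _ => Unit
  | seq p q => p.Label ⊕ q.Label
  | loop _ p => Option p.Label

/-- The label at which a program is entered. -/
def entry : (p : StackProg K Γ) → p.Label
  | skip => ()
  | push _ _ => ()
  | seq p _ => Sum.inl p.entry
  | loop _ _ => (none : Option _)

theorem finite_label : (p : StackProg K Γ) → Finite p.Label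
  | skip => inferInstanceAs (Finite Unit)
  | push _ _ => inferInstanceAs (Finite Unit)
  | seq p q => by
    have := p.finite_label
    have := q.finite_label
    exact inferInstanceAs (Finite (p.Label ⊕ q.Label))
  | loop _ p => by
    have := p.finite_label
    exact inferInstanceAs (Finite (Option p.Label))

variable [DecidableEq K]

/-- The statements of a program, as a part of a machine with labels `Λ` that goes on at `exit`. -/
def code {Λ : Type} : (p : StackProg K Γ) → (p.Label → Λ) → Λ → p.Label →
    TM2.Stmt Γ Λ (∀ k, Option (Γ k))
  | skip, _, exit, _ => .goto fun _ => exit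
  | push k f, _, exit, _ => .push k f (.goto fun _ => exit)
  | seq p q, emb, exit, l =>
    match l with
    | Sum.inl l => p.code (emb ∘ Sum.inl) (emb (Sum.inr q.entry)) l
    | Sum.inr l => q.code (emb ∘ Sum.inr) exit l
  | loop k p, emb, exit, l =>
    match l with
    | none => .pop k (fun r a => update r k a)
        (.branch (fun r => (r k).isSome) (.goto fun _ => emb (some p.entry)) (.goto fun _ => exit))
    | some l => p.code (emb ∘ some) (emb none) l

/-- `Exec r p S S' t`: the program `p`, started with registers `r` and stacks `S`, ends within `t`
steps with the same registers and the stacks `S'`. -/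
inductive Exec : (∀ k, Option (Γ k)) → StackProg K Γ → (∀ k, List (Γ k)) → (∀ k, List (Γ k)) → ℕ →
    Prop
  | skip {r S} : Exec r .skip S S 1
  | push {r S k f} : Exec r (.push k f) S (update S k (f r :: S k)) 1
  | seq {r p q S S' S'' t t'} : Exec r p S S' t → Exec r q S' S'' t' →
      Exec r (.seq p q) S S'' (t + t')
  | loop_nil {r S k p} : r k = none → S k = [] → Exec r (.loop k p) S S 1
  | loop_cons {r S S' S'' k p a l t t'} : r k = none → S k = a :: l →
      Exec (update r k (some a)) p (update S k l) S' t → Exec r (.loop k p) S' S'' t' →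
      Exec r (.loop k p) S S'' (1 + t + t')
  | mono {r p S S' t t'} : Exec r p S S' t → t ≤ t' → Exec r p S S' t'

/-- The invariant rule for loops. `S d l` describes the stacks when the symbols of `d` have been
popped, the latest first, and `l` is still to come. The extra `1` per round, and the last one, pay
for the pops. -/
theorem Exec.loop {k : K} {p : StackProg K Γ} {r : ∀ k, Option (Γ k)} {t : ℕ}
    (S : List (Γ k) → List (Γ k) → ∀ k, List (Γ k)) (l : List (Γ k)) (hr : r k = none)
    (hS : ∀ d l, S d l k = l)
    (hp : ∀ d a l', d.reverse ++ a :: l' = l →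
      Exec (update r k (some a)) p (update (S d (a :: l')) k l') (S (a :: d) l') t) :
    Exec r (.loop k p) (S [] l) (S l.reverse []) (l.length * (t + 1) + 1) := by
  suffices H : ∀ l' d, d.reverse ++ l' = l →
      Exec r (.loop k p) (S d l') (S (l'.reverse ++ d) []) (l'.length * (t + 1) + 1) by
    simpa using H l [] rfl
  intro l'
  induction l' with
  | nil => exact fun d _ => by simpa using Exec.loop_nil hr (hS d [])
  | cons a l' ih =>
    intro d hd
    have := ih (a :: d) (by simpa using hd)
    rw [List.reverse_cons, List.append_assoc, List.singleton_append]
    refine (Exec.loop_cons hr (hS _ _) (hp d a l' hd) this).mono ?_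
    rw [List.length_cons]
    ring_nf
    omega

/-- A machine `M` that contains the code of `p` runs it as described by `Exec`. -/
theorem Exec.iterate {Λ : Type} {M : Λ → TM2.Stmt Γ Λ (∀ k, Option (Γ k))}
    {r : ∀ k, Option (Γ k)} {p : StackProg K Γ} {S S' : ∀ k, List (Γ k)} {t : ℕ}
    (h : Exec r p S S' t) {emb : p.Label → Λ} {exit : Λ}
    (hM : ∀ l, M (emb l) = p.code emb exit l) :
    ∃ n, n + 1 ≤ t ∧ (flip bind (TM2.step M))^[n] (some (TM2.stepAux (M (emb p.entry)) r S)) =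
      some ⟨some exit, r, S'⟩ := by
  -- Runs are counted from the moment when the statement at the entry label has been carried out;
  -- starting at the label itself costs one more step.
  have go : ∀ {n : ℕ} {l r S} {c : Option (TM2.Cfg Γ Λ (∀ k, Option (Γ k)))},
      (flip bind (TM2.step M))^[n] (some (TM2.stepAux (M l) r S)) = c →
      (flip bind (TM2.step M))^[n + 1] (some ⟨some l, r, S⟩) = c := fun h => by
    rw [iterate_succ_apply]
    exact h
  induction h generalizing exit with
  | skip => exact ⟨0, le_rfl, by rw [hM]; rfl⟩
  | push => exact ⟨0, le_rfl, by rw [hM]; rfl⟩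
  | @seq r p q S S' S'' t t' _ _ ih ih' =>
    obtain ⟨n, hn, e⟩ := @ih (emb ∘ Sum.inl) (emb (Sum.inr q.entry)) (fun l => hM (Sum.inl l))
    obtain ⟨n', hn', e'⟩ := @ih' (emb ∘ Sum.inr) exit (fun l => hM (Sum.inr l))
    refine ⟨n' + 1 + n, by omega, ?_⟩
    rw [iterate_add_apply]
    refine (congrArg _ e).trans (go e')
  | @loop_nil r S k p hr hS =>
    refine ⟨0, le_rfl, ?_⟩
    rw [hM]
    -- Popping an empty stack writes `none` into the register, which is what it held before the
    -- loop.
    have h1 : update r k (S k).head? = r := by rw [hS, List.head?_nil, ← hr, update_eq_self]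
    have h2 : update S k (S k).tail = S := by rw [hS, List.tail_nil, ← hS, update_eq_self]
    simp [code, entry, h1, h2, hr]
  | @loop_cons r S S' S'' k p a l t t' hr hS _ _ ih ih' =>
    obtain ⟨n, hn, e⟩ := @ih (emb ∘ some) (emb none) (fun l => hM (some l))
    obtain ⟨n', hn', e'⟩ := @ih' emb exit hM
    -- The register still holds `a` when the body returns, but the loop starts with a pop that
    -- overwrites it.
    have h0 : TM2.stepAux (M (emb (entry (.loop k p)))) (update r k (some a)) S' =
        TM2.stepAux (M (emb (entry (.loop k p)))) r S' := by
      rw [hM]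
      simp [code, entry]
    refine ⟨n' + 1 + (n + 1), by omega, ?_⟩
    rw [iterate_add_apply]
    have h1 : TM2.stepAux (M (emb (entry (.loop k p)))) r S =
        ⟨some (emb (some p.entry)), update r k (some a), update S k l⟩ := by
      rw [hM]
      simp [code, entry, hS]
    rw [h1]
    refine (congrArg _ (go e)).trans (go ?_)
    exact (congrArg (fun c => (flip bind (TM2.step M))^[n'] (some c)) h0).trans e'
  | mono _ hle ih =>
    obtain ⟨n, hn, e⟩ := ih hM
    exact ⟨n, hn.trans hle, e⟩

/-- The machine that runs a program and halts. -/
noncomputable def machine [Fintype K] [∀ k, Fintype (Γ k)] (p : StackProg K Γ) (k₀ k₁ : K) :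
    FinTM2 :=
  have := p.finite_label
  { K := K
    k₀ := k₀
    k₁ := k₁
    Γ := Γ
    Λ := Option p.Label
    main := some p.entry
    ΛFin := Fintype.ofFinite _
    σ := ∀ k, Option (Γ k)
    initialState := fun _ => none
    σFin := Fintype.ofFinite _
    m := fun l => match l with
      | none => .halt
      | some l => p.code some none l }

theorem polyTimeComputable [Fintype K] [∀ k, Finite (Γ k)] (p : StackProg K Γ) (k₀ k₁ : K)
    {α β : Type} {ea : α → List (Γ k₀)} {eb : β → List (Γ k₁)} {f : α → β} (T : Polynomial ℕ)
    (h : ∀ a, Exec (fun _ => none) p (update (fun _ => []) k₀ (ea a))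
      (update (fun _ => []) k₁ (eb (f a))) (T.eval (ea a).length)) :
    PolyTimeComputable ea eb f := by
  classical
  have : ∀ k, Fintype (Γ k) := fun k => Fintype.ofFinite _
  refine ⟨{ tm := p.machine k₀ k₁, inputAlphabet := Equiv.refl _, outputAlphabet := Equiv.refl _,
            time := T + 1, outputsFun := fun a => Classical.choice ?_ },
    fun k => (inferInstance : ∀ k, Finite (Γ k)) k⟩
  obtain ⟨n, hn, e⟩ := (h a).iterate (M := (p.machine k₀ k₁).m) (emb := some) (exit := none)
    (fun l => rfl)
  -- One step executes the entry statement and one executes `.halt` at the exit label.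
  refine ⟨⟨⟨n + 2, ?_⟩, by simp; omega⟩⟩
  have h0 : initList (p.machine k₀ k₁) (List.map (Equiv.refl (Γ k₀)).invFun (ea a)) =
      ⟨some (some p.entry), fun _ => none, update (fun _ => []) k₀ (ea a)⟩ := by
    simp only [initList, machine]
    congr 1
    funext k
    refine Eq.trans (b := update (β := fun k => List (Γ k)) (fun _ => []) k₀ (ea a) k) ?_ rfl
    by_cases hk : k = k₀
    · subst hk
      simp
      rfl
    · rw [update_of_ne hk]
      exact dif_neg hk
  have h1 : haltList (p.machine k₀ k₁) (List.map (Equiv.refl (Γ k₁)).invFun (eb (f a))) =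
      ⟨none, fun _ => none, update (fun _ => []) k₁ (eb (f a))⟩ := by
    simp only [haltList, machine]
    congr 1
    funext k
    refine Eq.trans (b := update (β := fun k => List (Γ k)) (fun _ => []) k₁ (eb (f a)) k) ?_ rfl
    by_cases hk : k = k₁
    · subst hk
      simp
      rfl
    · rw [update_of_ne hk]
      exact dif_neg hk
  rw [Option.map_some]
  erw [h1, h0]
  rw [show n + 2 = 1 + n + 1 by ring, iterate_succ_apply, iterate_add_apply]
  exact congrArg (flip bind (TM2.step (p.machine k₀ k₁).m)) e

end StackProg

/-! ### Generating words from a row of cells in polynomial time -/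

/-- A piece of a template: a symbol, which may depend on the content of the current cell, or a block
that is written once for each cell before the current one. -/
inductive TemplateToken (S β : Type) : Type
  | sym (f : Option S → β)
  | block (l : List β)

namespace TemplateToken

variable {S β : Type}

/-- The word denoted by a token, for a cell with content `a` that is preceded by `j` cells. -/
def expand (j : ℕ) (a : Option S) : TemplateToken S β → List β
  | sym f => [f a]
  | block l => (List.replicate j l).flatten

/-- A factor for the time that is needed to write a token. -/
def cost : TemplateToken S β → ℕ
  | sym _ => 1
  | block l => l.length + 6

end TemplateToken

/-- A template for a word that is generated in one pass over a row of cells. -/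
structure RowTemplate (S β : Type) where
  /-- to be written before the pass -/
  pre : List (TemplateToken S β)
  /-- to be written for each cell -/
  body : List (TemplateToken S β)
  /-- to be written after the pass -/
  post : List (TemplateToken S β)

namespace RowTemplate

variable {S β : Type}

/-- The word generated from the row `y`. -/
def expand (y : List S) (s : RowTemplate S β) : List β :=
  s.pre.flatMap (TemplateToken.expand 0 none) ++
    (y.zipIdx.flatMap (fun c => s.body.flatMap (TemplateToken.expand c.2 (some c.1))) ++
      s.post.flatMap (TemplateToken.expand y.length none))

end RowTemplate

/-- The row of cells that has `P` blanks and an extra cell on the left of a given word, and `P` blanks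
on its right. -/
def paddedRow {S : Type} (blank star : S) (P : ℕ) (l : List S) : List S :=
  List.replicate P blank ++ star :: (l ++ List.replicate P blank)

/-- The stacks used for generating words from rows. -/
inductive RowStack : Type
  | inp | left | aux | right | spare | buf | out
  deriving DecidableEq

namespace RowStack

open StackProg Function

instance : Fintype RowStack where
  elems := {.inp, .left, .aux, .right, .spare, .buf, .out}
  complete s := by cases s <;> decide

/-- The stack alphabets. -/
abbrev Alph (I S β : Type) : RowStack → Type
  | inp => I
  | left => S
  | aux => S
  | right => S
  | spare => S
  | buf => β
  | out => β

variable {I S β : Type}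

instance [Finite I] [Finite S] [Finite β] (k : RowStack) : Finite (Alph I S β k) := by
  cases k <;> infer_instance

/-- The stacks with given contents. -/
def stk (i : List I) (a b c d : List S) (o o' : List β) : ∀ k, List (Alph I S β k)
  | inp => i
  | left => a
  | aux => b
  | right => c
  | spare => d
  | buf => o
  | out => o'

section

variable (i i' : List I) (a b c d a' : List S) (o o' o'' : List β)

theorem update_inp : update (stk i a b c d o o') inp i' = stk i' a b c d o o' := by
  funext k; cases k <;> rfl

theorem update_left : update (stk i a b c d o o') left a' = stk i a' b c d o o' := by
  funext k; cases k <;> rfl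

theorem update_aux : update (stk i a b c d o o') aux a' = stk i a a' c d o o' := by
  funext k; cases k <;> rfl

theorem update_right : update (stk i a b c d o o') right a' = stk i a b a' d o o' := by
  funext k; cases k <;> rfl

theorem update_spare : update (stk i a b c d o o') spare a' = stk i a b c a' o o' := by
  funext k; cases k <;> rfl

theorem update_buf : update (stk i a b c d o o') buf o'' = stk i a b c d o'' o' := by
  funext k; cases k <;> rfl

theorem update_out : update (stk i a b c d o o') out o'' = stk i a b c d o o'' := by
  funext k; cases k <;> rfl

end

/-- The registers. -/
abbrev Reg (I S β : Type) : Type := ∀ k, Option (Alph I S β k)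

/-- Programs run in sequence. -/
def seqs (l : List (StackProg RowStack (Alph I S β))) : StackProg RowStack (Alph I S β) :=
  l.foldr .seq .skip

variable {r : Reg I S β} {i : List I} {a b c d : List S} {o o' : List β}

theorem exec_push_left {f : Reg I S β → S} :
    Exec r (.push left f) (stk i a b c d o o') (stk i (f r :: a) b c d o o') 1 := by
  rw [← update_left i a b c d (f r :: a) o o']
  exact .push

theorem exec_push_aux {f : Reg I S β → S} :
    Exec r (.push aux f) (stk i a b c d o o') (stk i a (f r :: b) c d o o') 1 := by
  rw [← update_aux i a b c d (f r :: b) o o']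
  exact .push

theorem exec_push_right {f : Reg I S β → S} :
    Exec r (.push right f) (stk i a b c d o o') (stk i a b (f r :: c) d o o') 1 := by
  rw [← update_right i a b c d (f r :: c) o o']
  exact .push

theorem exec_push_spare {f : Reg I S β → S} :
    Exec r (.push spare f) (stk i a b c d o o') (stk i a b c (f r :: d) o o') 1 := by
  rw [← update_spare i a b c d (f r :: d) o o']
  exact .push

theorem exec_push_buf {f : Reg I S β → β} :
    Exec r (.push buf f) (stk i a b c d o o') (stk i a b c d (f r :: o) o') 1 := by
  rw [← update_buf i a b c d o o' (f r :: o)]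
  exact .push

theorem exec_push_out {f : Reg I S β → β} :
    Exec r (.push out f) (stk i a b c d o o') (stk i a b c d o (f r :: o')) 1 := by
  rw [← update_out i a b c d o o' (f r :: o')]
  exact .push

/-! ### Expanding a template in one pass over the row -/

section emit

variable [Inhabited S]

/-- Write a constant word. -/
def emitConst (l : List β) : StackProg RowStack (Alph I S β) :=
  seqs (l.map fun s => .push buf fun _ => s)

omit [Inhabited S] in
theorem exec_emitConst (l : List β) (o : List β) :
    Exec r (emitConst l) (stk i a b c d o o') (stk i a b c d (l.reverse ++ o) o')
      (l.length + 1) := by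
  induction l generalizing o with
  | nil => exact .skip
  | cons s l ih =>
    have := Exec.seq (exec_push_buf (r := r) (i := i) (a := a) (b := b) (c := c) (d := d) (o := o)
      (o' := o') (f := fun _ => s)) (ih (s :: o))
    rw [List.reverse_cons, List.append_assoc, List.singleton_append]
    exact this.mono (by rw [List.length_cons]; omega)

/-- Write a token. The cells before the current one are on the stack `left`. -/
def emitToken : TemplateToken S β → StackProg RowStack (Alph I S β)
  | .sym f => .push buf fun r => f (r right)
  | .block l => .seq (.loop left (.seq (.push aux fun r => (r left).getD (default : S)) (emitConst l)))
      (.loop aux (.push left fun r => (r aux).getD (default : S)))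

/-- A block is written once for each symbol moved from `left` to `aux`; a second loop moves the
symbols back. The height of `left` thus serves as the index of the current cell. The output on `buf`
grows backwards. -/
theorem exec_emitToken (hl : r left = none) (ha : r aux = none) (t : TemplateToken S β) :
    Exec r (emitToken t) (stk i a [] c d o o')
      (stk i a [] c d ((t.expand a.length (r right)).reverse ++ o) o')
      (t.cost * (a.length + 1)) := by
  cases t with
  | sym f => exact exec_push_buf.mono (by simp [TemplateToken.cost])
  | block l =>
    have h1 := Exec.loop (k := left) (r := r)
      (p := .seq (.push aux fun r => (r left).getD (default : S)) (emitConst l))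
      (fun e l' => stk i l' e c d ((List.replicate e.length l).flatten.reverse ++ o) o') a hl
      (fun _ _ => rfl) (t := 1 + (l.length + 1)) (by
        intro e s l' _
        rw [update_left]
        refine .seq exec_push_aux ?_
        have := exec_emitConst (r := update r left (some s)) (i := i) (a := l') (b := s :: e)
          (c := c) (d := d) (o' := o') l ((List.replicate e.length l).flatten.reverse ++ o)
        convert this using 2
        · simp
        · rw [List.length_cons, List.replicate_succ', List.flatten_append, List.reverse_append]
          simp)
    have h2 := Exec.loop (k := aux) (r := r)
      (p := .push left fun r => (r aux).getD (default : S))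
      (fun e l' => stk i e l' c d ((List.replicate a.length l).flatten.reverse ++ o) o') a.reverse ha
      (fun _ _ => rfl) (t := 1) (by
        intro e s l' _
        rw [update_aux]
        convert exec_push_left using 2
        simp)
    rw [List.reverse_reverse] at h2
    rw [List.length_reverse] at h1 h2
    refine (Exec.seq h1 h2).mono ?_
    simp only [TemplateToken.cost]
    ring_nf
    nlinarith

/-- Write a list of tokens. -/
def emitTokens (l : List (TemplateToken S β)) : StackProg RowStack (Alph I S β) :=
  seqs (l.map emitToken)

theorem exec_emitTokens (hl : r left = none) (ha : r aux = none) (l : List (TemplateToken S β))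
    (o : List β) :
    Exec r (emitTokens l) (stk i a [] c d o o')
      (stk i a [] c d ((l.flatMap (TemplateToken.expand a.length (r right))).reverse ++ o) o')
      ((l.map TemplateToken.cost).sum * (a.length + 1) + 1) := by
  induction l generalizing o with
  | nil => exact .mono .skip (by simp)
  | cons t l ih =>
    have := Exec.seq (exec_emitToken (i := i) (a := a) (c := c) (d := d) (o := o) (o' := o') hl ha t)
      (ih _)
    rw [List.flatMap_cons, List.reverse_append, List.append_assoc]
    exact this.mono (by rw [List.map_cons, List.sum_cons]; ring_nf; omega)

/-- Expand a template, in one pass over the row on the stack `right`. -/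
def emitRow (s : RowTemplate S β) : StackProg RowStack (Alph I S β) :=
  .seq (emitTokens s.pre) (.seq
    (.loop right (.seq (emitTokens s.body) (.push left fun r => (r right).getD (default : S))))
    (.seq (emitTokens s.post) (.loop left (.push right fun r => (r left).getD (default : S)))))

open Polynomial in
-- During the pass `left` holds the cells already treated, and the register of `right` the current
-- one. At the end the cells return to `right`, so that the next template finds the same row.
theorem exec_emitRow (s : RowTemplate S β) : ∃ T : ℕ[X], ∀ (y : List S) (o : List β),
    Exec (fun _ => none) (emitRow s) (stk i [] [] y d o o')
      (stk i [] [] y d ((s.expand y).reverse ++ o) o') (T.eval y.length) := by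
  let cost (l : List (TemplateToken S β)) : ℕ := (l.map TemplateToken.cost).sum
  refine ⟨C (cost s.pre + 1) + ((X * (C (cost s.body) * (X + 1) + 1 + 1 + 1) + 1) +
    ((C (cost s.post) * (X + 1) + 1) + (X * (1 + 1) + 1))), fun y o => ?_⟩
  have h1 := exec_emitTokens (r := fun _ => none) (i := i) (a := []) (c := y) (d := d) (o' := o')
    rfl rfl s.pre o
  set o₁ := (s.pre.flatMap (TemplateToken.expand 0 none)).reverse ++ o with ho₁
  let g : List S → List β := fun e =>
    e.zipIdx.flatMap (fun c => s.body.flatMap (TemplateToken.expand c.2 (some c.1)))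
  have h2 := Exec.loop (k := right) (r := fun _ => none)
    (p := .seq (emitTokens s.body) (.push left fun r => (r right).getD (default : S)))
    (fun e l' => stk i e [] l' d ((g e.reverse).reverse ++ o₁) o') y rfl
    (fun _ _ => rfl) (t := cost s.body * (y.length + 1) + 1 + 1) (by
      intro e a l' hl
      rw [update_right]
      refine .seq ((exec_emitTokens ?_ ?_ s.body _).mono ?_) ?_
      · rfl
      · rfl
      · rw [← hl]
        simp only [List.length_append, List.length_reverse, List.length_cons]
        gcongr
        omega
      · convert exec_push_left using 2
        · simp
        · simp [g, List.zipIdx_append])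
  have h3 := exec_emitTokens (r := fun _ => none) (i := i) (a := y.reverse) (c := []) (d := d)
    (o' := o') rfl rfl s.post ((g y).reverse ++ o₁)
  have h4 := Exec.loop (k := left) (r := fun _ => none)
    (p := .push right fun r => (r left).getD (default : S))
    (fun e l' => stk i l' [] e d ((s.expand y).reverse ++ o) o') y.reverse rfl
      (fun _ _ => rfl) (t := 1) (by
        intro e s l' _
        rw [update_left]
        convert exec_push_right using 2
        simp)
  rw [List.reverse_reverse] at h2 h4
  rw [List.length_reverse] at h3 h4
  have h5 : (s.post.flatMap (TemplateToken.expand y.length none)).reverse ++ ((g y).reverse ++ o₁) =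
      (s.expand y).reverse ++ o := by
    simp [RowTemplate.expand, g, ho₁]
  rw [h5] at h3
  refine (Exec.seq h1 (Exec.seq h2 (Exec.seq h3 h4))).mono (le_of_eq ?_)
  simp only [cost, Polynomial.eval_add, Polynomial.eval_mul, Polynomial.eval_C, Polynomial.eval_X,
    Polynomial.eval_one, List.length_nil, zero_add, mul_one]

end emit

/-! ### Producing the padded row and delivering the output -/

section prepare

open Polynomial

variable [Inhabited S] {n : ℕ} (blank star : S)

/-- Multiply the number of blanks on the stack `aux` by one more than the number of symbols on the
stack `left`. -/
def multiply : StackProg RowStack (Alph I S β) :=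
  .seq (.loop aux (.seq (.loop left (.seq (.push spare fun r => (r left).getD (default : S))
      (.push right fun _ => blank)))
    (.seq (.loop spare (.push left fun r => (r spare).getD (default : S)))
      (.push right fun _ => blank))))
    (.loop right (.push aux fun _ => blank))

theorem exec_multiply (N : ℕ) :
    Exec (fun _ => none) (multiply blank) (stk i a (List.replicate N blank) [] [] o o')
      (stk i a (List.replicate (N * (a.length + 1)) blank) [] [] o o')
      (N * (a.length * 5 + 3 + 1) + 1 + (N * (a.length + 1) * 2 + 1)) := by
  -- One round of the outer loop: a traversal of `left`, with `spare` as intermediate storage, gives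
  -- `a.length` blanks, and the final push gives the additional one.
  have inner (r : Reg I S β) (hl : r left = none) (hs : r spare = none) (b c : List S) :
      Exec r (.seq (.loop left (.seq (.push spare fun r => (r left).getD (default : S))
        (.push right fun _ => blank)))
        (.seq (.loop spare (.push left fun r => (r spare).getD (default : S)))
        (.push right fun _ => blank))) (stk i a b c [] o o')
        (stk i a b (List.replicate (a.length + 1) blank ++ c) [] o o')
        (a.length * 5 + 3) := by
    have h1 := Exec.loop (k := left) (r := r)
      (p := .seq (.push spare fun r => (r left).getD (default : S)) (.push right fun _ => blank))
      (fun e l' => stk i l' b (List.replicate e.length blank ++ c) e o o') a hl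
      (fun _ _ => rfl) (t := 1 + 1) (by
        intro e s l' _
        rw [update_left]
        refine .seq exec_push_spare ?_
        convert exec_push_right using 2
        · rw [List.length_cons, List.replicate_succ, List.cons_append]
        · simp)
    have h2 := Exec.loop (k := spare) (r := r)
      (p := .push left fun r => (r spare).getD (default : S))
      (fun e l' => stk i e b (List.replicate a.length blank ++ c) l' o o') a.reverse hs
      (fun _ _ => rfl) (t := 1) (by
        intro e s l' _
        rw [update_spare]
        convert exec_push_left using 2
        simp)
    rw [List.reverse_reverse] at h2
    rw [List.length_reverse] at h1 h2
    refine (Exec.seq h1 (Exec.seq h2 (exec_push_right (f := fun _ => blank)))).mono (by omega)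
  have h1 := Exec.loop (k := aux) (r := fun _ => none)
    (p := .seq (.loop left (.seq (.push spare fun r => (r left).getD (default : S))
        (.push right fun _ => blank)))
        (.seq (.loop spare (.push left fun r => (r spare).getD (default : S)))
        (.push right fun _ => blank)))
    (fun e l' => stk i a l' (List.replicate (e.length * (a.length + 1)) blank) [] o o')
    (List.replicate N blank) rfl (fun _ _ => rfl) (t := a.length * 5 + 3) (by
      intro e s l' _
      rw [update_aux]
      convert inner _ ?_ ?_ l' (List.replicate (e.length * (a.length + 1)) blank) using 2
      · rw [List.replicate_append_replicate, List.length_cons]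
        congr 1
        ring
      · rfl
      · rfl)
  have h2 := Exec.loop (k := right) (r := fun _ => none) (p := .push aux fun _ => blank)
    (fun e l' => stk i a (List.replicate e.length blank) l' [] o o')
    (List.replicate (N * (a.length + 1)) blank) rfl (fun _ _ => rfl) (t := 1) (by
      intro e s l' _
      rw [update_right]
      exact exec_push_aux)
  simp only [List.length_reverse, List.length_replicate, List.length_nil, zero_mul,
    List.replicate_zero] at h1 h2
  exact Exec.seq h1 h2

/-- Fill the stack `aux` with a polynomial number of blanks. -/
def power (m : ℕ) : ℕ → StackProg RowStack (Alph I S β)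
  | 0 => seqs (List.replicate m (.push aux fun _ => blank))
  | d + 1 => .seq (power m d) (multiply blank)

theorem exec_power (m d : ℕ) : ∃ T : ℕ[X], ∀ a : List S,
    Exec (fun _ => none) (power blank m d) (stk i a [] [] [] o o')
      (stk i a (List.replicate (m * (a.length + 1) ^ d) blank) [] [] o o') (T.eval a.length) := by
  induction d with
  | zero =>
    refine ⟨C (m + 1), fun a => ?_⟩
    have (b : List S) : Exec (fun _ => none) (power blank m 0) (stk i a b [] [] o o')
        (stk i a (List.replicate m blank ++ b) [] [] o o') (m + 1) := by
      induction m generalizing b with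
      | zero => exact .skip
      | succ m ih =>
        rw [List.replicate_succ', List.append_assoc, List.singleton_append]
        exact (Exec.seq (exec_push_aux (f := fun _ => blank)) (ih _)).mono (by omega)
    simpa using this []
  | succ d ih =>
    obtain ⟨T, hT⟩ := ih
    refine ⟨T + (C m * (X + 1) ^ d * (X * 5 + 3 + 1) + 1 + (C m * (X + 1) ^ d * (X + 1) * 2 + 1)),
      fun a => ?_⟩
    rw [pow_succ, ← mul_assoc]
    refine (Exec.seq (hT a) (exec_multiply blank _)).mono (le_of_eq ?_)
    simp

/-- Turn the input into a padded row, on the stack `right`. -/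
def prepare (e : I → S) (m d : ℕ) : StackProg RowStack (Alph I S β) :=
  .seq (.loop inp (.push left fun r => ((r inp).map e).getD (default : S))) (.seq (power blank m d)
    (.seq (.loop aux (.seq (.push right fun _ => blank) (.push spare fun _ => blank)))
    (.seq (.loop left (.push right fun r => (r left).getD (default : S)))
    (.seq (.push right fun _ => star) (.loop spare (.push right fun _ => blank))))))

/-- The row is stacked up from its right end. The blanks on `aux` are duplicated, onto `right` for
the right padding and onto `spare` for the left one. The input, reversed on `left`, regains its
order when it is moved to `right`. -/
theorem exec_prepare (e : I → S) (m d : ℕ) : ∃ T : ℕ[X], ∀ x : List I,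
    Exec (fun _ => none) (prepare (β := β) blank star e m d) (stk x [] [] [] [] o o')
      (stk [] [] [] (paddedRow blank star (m * (x.length + 1) ^ d) (x.map e)) [] o o')
      (T.eval x.length) := by
  obtain ⟨T, hT⟩ := exec_power (I := I) (β := β) (i := []) (o := o) (o' := o') blank m d
  refine ⟨X * 2 + 1 + (T + (C m * (X + 1) ^ d * 3 + 1 + (X * 2 + 1 + (1 +
    (C m * (X + 1) ^ d * 2 + 1))))), fun x => ?_⟩
  set P := m * (x.length + 1) ^ d with hP
  have h1 := Exec.loop (k := inp) (r := fun _ => none)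
    (p := .push left fun r : Reg I S β => ((r inp).map e).getD (default : S))
    (fun d l' => stk l' (d.map e) [] [] [] o o') x rfl (fun _ _ => rfl) (t := 1) (by
      intro d s l' _
      rw [update_inp]
      convert exec_push_left using 2
      simp)
  have h2 := hT (x.reverse.map e)
  have h3 := Exec.loop (k := aux) (r := fun _ => none)
    (p := .seq (.push right fun _ => blank) (.push spare fun _ => blank))
    (fun d l' => stk (I := I) [] (x.reverse.map e) l' (List.replicate d.length blank)
      (List.replicate d.length blank) o o') (List.replicate P blank) rfl (fun _ _ => rfl)
    (t := 1 + 1) (by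
      intro d s l' _
      rw [update_aux]
      exact .seq exec_push_right exec_push_spare)
  have h4 := Exec.loop (k := left) (r := fun _ => none)
    (p := .push right fun r => (r left).getD (default : S))
    (fun d l' => stk (I := I) [] l' [] (d ++ List.replicate P blank)
      (List.replicate P blank) o o') (x.reverse.map e) rfl (fun _ _ => rfl)
    (t := 1) (by
      intro d s l' _
      rw [update_left]
      convert exec_push_right using 2
      simp)
  have h5 := Exec.loop (k := spare) (r := fun _ => none)
    (p := .push right fun _ => blank)
    (fun d l' => stk (I := I) [] [] [] (List.replicate d.length blank ++
      star :: (x.map e ++ List.replicate P blank)) l' o o') (List.replicate P blank) rfl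
    (fun _ _ => rfl) (t := 1) (by
      intro d s l' _
      rw [update_spare]
      convert exec_push_right using 2
      rw [List.length_cons, List.replicate_succ, List.cons_append])
  simp only [List.length_reverse, List.length_replicate, List.length_map, List.length_nil,
    List.map_reverse, List.reverse_reverse, List.replicate_zero, List.nil_append, List.map_nil]
    at h1 h2 h3 h4 h5
  refine (Exec.seq h1 (.seq h2 (.seq h3 (.seq h4 (.seq exec_push_right h5))))).mono
    (le_of_eq ?_)
  simp [hP]

/-- Clear the row, and copy the result, which was generated backwards, to the output. -/
def finish [Inhabited β] : StackProg RowStack (Alph I S β) :=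
  .seq (.loop right .skip) (.loop buf (.push out fun r => (r buf).getD (default : β)))

omit [Inhabited S] in
theorem exec_finish [Inhabited β] (y : List S) (w : List β) :
    Exec (fun _ => none) finish (stk i a b y d w.reverse [])
      (stk i a b [] d [] w) (y.length * 2 + 1 + (w.length * 2 + 1)) := by
  have h1 := Exec.loop (k := right) (r := fun _ => none) (p := .skip)
    (fun _ l' => stk i a b l' d w.reverse []) y rfl (fun _ _ => rfl) (t := 1) (by
      intro d s l' _
      rw [update_right]
      exact .skip)
  have h2 := Exec.loop (k := buf) (r := fun _ => none)
    (p := .push out fun r => (r buf).getD (default : β))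
    (fun e l' => stk i a b [] d l' e) w.reverse rfl (fun _ _ => rfl) (t := 1) (by
      intro d s l' _
      rw [update_buf]
      convert exec_push_out using 2
      simp)
  rw [List.reverse_reverse, List.length_reverse] at h2
  exact .seq h1 h2

end prepare

end RowStack

/-! ### Polynomial-time computability from templates -/

namespace RowTemplate

open RowStack Polynomial StackProg

variable {I S β : Type}

/-- Needed for the time of `finish`, which copies the whole output. -/
theorem length_expand_le (s : RowTemplate S β) : ∃ T : ℕ[X], ∀ y : List S,
    (s.expand y).length ≤ T.eval y.length := by
  let cost (l : List (TemplateToken S β)) : ℕ := (l.map TemplateToken.cost).sum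
  have key (l : List (TemplateToken S β)) (j : ℕ) (a : Option S) :
      (l.flatMap (TemplateToken.expand j a)).length ≤ cost l * (j + 1) := by
    induction l with
    | nil => simp
    | cons t l ih =>
      have : (t.expand j a).length ≤ t.cost * (j + 1) := by
        cases t with
        | sym f => simp [TemplateToken.expand, TemplateToken.cost]
        | block l =>
          simp only [TemplateToken.expand, TemplateToken.cost, List.length_flatten,
            List.map_replicate, List.sum_replicate, smul_eq_mul]
          nlinarith
      simp only [cost, List.map_cons, List.sum_cons, List.flatMap_cons, List.length_append] at ih ⊢
      nlinarith
  refine ⟨C (cost s.pre) + (X * (C (cost s.body) * (X + 1)) + C (cost s.post) * (X + 1)),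
    fun y => ?_⟩
  simp only [expand, List.length_append, eval_add, eval_mul, eval_C, eval_X, eval_one]
  refine add_le_add (by simpa using key s.pre 0 none) (add_le_add ?_ (key _ _ _))
  rw [List.length_flatMap]
  refine (List.sum_le_card_nsmul _ (cost s.body * (y.length + 1)) ?_).trans (by simp)
  intro k hk
  obtain ⟨⟨b, j⟩, hc, rfl⟩ := List.mem_map.1 hk
  refine (key _ _ _).trans (Nat.mul_le_mul_left _ ?_)
  have := List.mem_zipIdx hc
  simp only at this ⊢
  omega

/-- A map is computable in polynomial time if its values are written as expansions of fixed templates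
over the padded input. -/
theorem polyTimeComputable [Finite I] [Finite S] [Finite β] [Inhabited β] {γ : Type}
    {enc : γ → List β} {f : List I → γ} (blank star : S) (e : I → S) (m d : ℕ)
    (l : List (RowTemplate S β))
    (h : ∀ x, enc (f x) =
      l.flatMap (expand (paddedRow blank star (m * (x.length + 1) ^ d) (x.map e)))) :
    PolyTimeComputable (fun x : List I => x) enc f := by
  have : Inhabited S := ⟨blank⟩
  have rows : ∃ T : ℕ[X], ∀ (y : List S) (o : List β),
      Exec (fun _ => none) (seqs (l.map emitRow)) (stk ([] : List I) [] [] y [] o [])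
        (stk [] [] [] y [] ((l.flatMap (expand y)).reverse ++ o) []) (T.eval y.length) ∧
      (l.flatMap (expand y)).length ≤ T.eval y.length := by
    clear h
    induction l with
    | nil => exact ⟨1, fun y o => ⟨(Exec.skip).mono (by simp), by simp⟩⟩
    | cons s l ih =>
      obtain ⟨T, hT⟩ := ih
      obtain ⟨U, hU⟩ := exec_emitRow (I := I) (i := []) (d := []) (o' := []) s
      obtain ⟨V, hV⟩ := length_expand_le s
      refine ⟨U + T + V, fun y o => ⟨?_, ?_⟩⟩
      · rw [List.flatMap_cons, List.reverse_append, List.append_assoc]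
        exact (Exec.seq (hU y o) (hT y _).1).mono (by simp)
      · have h1 := (hT y o).2
        have h2 := hV y
        simp only [List.flatMap_cons, List.length_append, eval_add]
        omega
  obtain ⟨T, hT⟩ := rows
  obtain ⟨U, hU⟩ := exec_prepare (β := β) (o := []) (o' := []) blank star e m d
  -- The length of the padded row as a polynomial in the input length; bounds in terms of the row
  -- are composed with it.
  let Y : ℕ[X] := C m * (X + 1) ^ d * 2 + X + 1
  have hY (x : List I) : Y.eval x.length =
      (paddedRow blank star (m * (x.length + 1) ^ d) (x.map e)).length := by
    simp [Y, paddedRow]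
    ring
  refine StackProg.polyTimeComputable
    (.seq (prepare blank star e m d) (.seq (seqs (l.map emitRow)) finish)) inp out
    (U + (T.comp Y + (Y * 2 + 1 + (T.comp Y * 2 + 1)))) fun x => ?_
  set y := paddedRow blank star (m * (x.length + 1) ^ d) (x.map e) with hy
  have h1 := (hT y []).1
  rw [List.append_nil] at h1
  have := Exec.seq (hU x) (.seq h1 (exec_finish y _))
  rw [h]
  have e1 : (fun _ => [] : ∀ k, List (Alph I S β k)) = stk [] [] [] [] [] [] [] := by
    funext k; cases k <;> rfl
  rw [e1, update_inp, update_out]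
  refine this.mono ?_
  have h2 := (hT y []).2
  simp only [eval_add, eval_mul, eval_comp, hY, eval_one, eval_ofNat]
  rw [← hy]
  omega

end RowTemplate

/-! ### Acceptance by alternating automata -/

namespace PosFormula

variable {Q Q' : Type}

/-- The value of a formula under a valuation of its atoms. -/
def Sat (v : Q → Prop) : PosFormula Q → Prop
  | atom q => v q
  | and φ ψ => φ.Sat v ∧ ψ.Sat v
  | or φ ψ => φ.Sat v ∨ ψ.Sat v

/-- Renaming of atoms. -/
def map (g : Q → Q') : PosFormula Q → PosFormula Q'
  | atom q => atom (g q)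
  | and φ ψ => and (φ.map g) (ψ.map g)
  | or φ ψ => or (φ.map g) (ψ.map g)

/-- All atoms of a formula satisfy `P`. -/
def All (P : Q → Prop) : PosFormula Q → Prop
  | atom q => P q
  | and φ ψ => φ.All P ∧ ψ.All P
  | or φ ψ => φ.All P ∧ ψ.All P

theorem sat_map (g : Q → Q') (v : Q' → Prop) (φ : PosFormula Q) :
    (φ.map g).Sat v ↔ φ.Sat fun q => v (g q) := by
  induction φ with
  | atom q => rfl
  | and φ ψ ih ih' => exact and_congr ih ih'
  | or φ ψ ih ih' => exact or_congr ih ih'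

theorem all_map (g : Q → Q') (P : Q' → Prop) (φ : PosFormula Q) :
    (φ.map g).All P ↔ φ.All fun q => P (g q) := by
  induction φ with
  | atom q => rfl
  | and φ ψ ih ih' => exact and_congr ih ih'
  | or φ ψ ih ih' => exact and_congr ih ih'

/-- The disjunction of a list of formulas and of the atom `e`. -/
def disj (e : Q) (l : List (PosFormula Q)) : PosFormula Q :=
  l.foldr or (atom e)

theorem sat_disj (v : Q → Prop) (e : Q) (l : List (PosFormula Q)) :
    (disj e l).Sat v ↔ (∃ φ ∈ l, φ.Sat v) ∨ v e := by
  induction l with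
  | nil => simp [disj, Sat]
  | cons φ l ih =>
    simp only [disj, List.foldr_cons, Sat] at ih ⊢
    rw [ih]
    simp [or_assoc]

theorem all_disj (P : Q → Prop) (e : Q) (l : List (PosFormula Q)) :
    (disj e l).All P ↔ (∀ φ ∈ l, φ.All P) ∧ P e := by
  induction l with
  | nil => simp [disj, All]
  | cons φ l ih =>
    simp only [disj, List.foldr_cons, All] at ih ⊢
    rw [ih]
    simp [and_assoc]

end PosFormula

namespace AFA

open PosFormula

variable {α Q : Type} (A : AFA α Q)

/-- The word is accepted from the given state. -/
def Accepts : List α → Q → Prop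
  | [], q => q ∈ A.final
  | a :: w, q => (A.δ q a).Sat (Accepts w)

variable {A}

/-- Adam keeps the current formula false: a false conjunction has a false conjunct for him to
choose, and both disjuncts of a false disjunction are false, whatever `σ` does. -/
theorem Play.exists_losing {σ : Strategy α} (w : List α) {h : List (Move α)} {w' : List α}
    {φ : PosFormula Q} (hp : A.Play σ h w' φ) (hφ : ¬ φ.Sat (A.Accepts w)) :
    ∃ h' q, A.Play σ h' (w' ++ w) (.atom q) ∧ q ∉ A.final := by
  induction w generalizing h w' φ with
  | nil =>
    induction φ generalizing h with
    | atom q => exact ⟨h, q, by simpa using hp, hφ⟩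
    | and φ ψ ih ih' =>
      rcases not_and_or.1 hφ with h1 | h1
      · exact ih (hp.adam false) h1
      · exact ih' (hp.adam true) h1
    | or φ ψ ih ih' =>
      obtain ⟨h1, h2⟩ := not_or.1 hφ
      have := hp.eve
      cases hb : σ h <;> rw [hb] at this
      · exact ih this h1
      · exact ih' this h2
  | cons a w ihw =>
    induction φ generalizing h with
    | atom q =>
      obtain ⟨h', q', h1, h2⟩ := ihw (hp.letter a) hφ
      exact ⟨h', q', by simpa using h1, h2⟩
    | and φ ψ ih ih' =>
      rcases not_and_or.1 hφ with h1 | h1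
      · exact ih (hp.adam false) h1
      · exact ih' (hp.adam true) h1
    | or φ ψ ih ih' =>
      obtain ⟨h1, h2⟩ := not_or.1 hφ
      have := hp.eve
      cases hb : σ h <;> rw [hb] at this
      · exact ih this h1
      · exact ih' this h2

variable (A) in
/-- The position that is reached by a move. -/
def next : PosFormula Q → Move α → PosFormula Q
  | .atom q, .inl a => A.δ q a
  | .and φ ψ, .inr b => bif b then ψ else φ
  | .or φ ψ, .inr b => bif b then ψ else φ
  | φ, _ => φ

/-- This lets a strategy, which sees only the history, recover the position and the word read so
far. -/
theorem Play.foldl_next {σ : Strategy α} {h : List (Move α)} {w : List α} {φ : PosFormula Q}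
    (hp : A.Play σ h w φ) : h.foldl A.next (.atom A.init) = φ ∧ h.filterMap Sum.getLeft? = w := by
  induction hp with
  | start => exact ⟨rfl, rfl⟩
  | letter a _ ih => simp [ih.1, ih.2, next]
  | adam b _ ih => simp [ih.1, ih.2, next]
  | eve _ ih => simp [ih.1, ih.2, next]

theorem mem_language_iff {w : List α} : w ∈ A.language ↔ A.Accepts w A.init := by
  classical
  constructor
  · rintro ⟨σ, hσ⟩
    by_contra h
    obtain ⟨h', q, h1, h2⟩ := Play.exists_losing (σ := σ) w .start h
    exact h2 (hσ _ _ h1)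
  · intro h
    -- Eve knows `w`, hence the part still to be read, and goes right only if the left disjunct is
    -- false for it.
    let σ : Strategy α := fun h =>
      match h.foldl A.next (.atom A.init) with
      | .or φ _ => decide (¬ φ.Sat (A.Accepts (w.drop (h.filterMap Sum.getLeft?).length)))
      | _ => false
    have key : ∀ {h w' φ}, A.Play σ h w' φ → ∀ u, w' ++ u = w → φ.Sat (A.Accepts u) := by
      intro h w' φ hp
      induction hp with
      | start =>
        rintro u rfl
        assumption
      | letter a _ ih =>
        intro u hu
        exact ih (a :: u) (by simpa using hu)
      | adam b _ ih =>
        intro u hu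
        have := ih u hu
        cases b
        · exact this.1
        · exact this.2
      | @eve h' w' φ ψ hp ih =>
        intro u hu
        have h1 := ih u hu
        have h2 : σ h' = decide (¬ φ.Sat (A.Accepts u)) := by
          simp only [σ, hp.foldl_next.1, hp.foldl_next.2, ← hu, List.drop_left]
        by_cases h3 : φ.Sat (A.Accepts u)
        · simp [h2, h3]
        · simpa [h2, h3] using h1.resolve_left h3
    exact ⟨σ, fun h q hp => key hp [] w.append_nil⟩

theorem isExistsGFG_of_forall_not_accepts (h : ∀ w, ¬ A.Accepts w A.init) : A.IsExistsGFG :=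
  ⟨fun _ => false, fun _ _ _ _ => Or.inl fun hw => h _ (mem_language_iff.1 hw)⟩

end AFA

/-! ### Cellular automata -/

/-- A cellular automaton with cell contents `S`, working on rows of cells between cells of constant
content. -/
structure CellAutomaton (S : Type) where
  /-- the next content of a cell, given the contents of the left neighbour, of the cell, and of
  the right neighbour -/
  rule : S → S → S → S
  /-- the content of the boundary cells -/
  blank : S

namespace CellAutomaton

variable {S S' : Type} (C : CellAutomaton S) (y : List S)

/-- The initial content of cell `i`. The cells of the row are numbered from `1`. -/
def initial : ℕ → S
  | 0 => C.blank
  | i + 1 => y[i]?.getD C.blank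

/-- The content of cell `i` at time `t`. -/
def row : ℕ → ℕ → S
  | 0, i => C.initial y i
  | t + 1, i =>
    if i = 0 ∨ y.length < i then C.blank
    else C.rule (row t (i - 1)) (row t i) (row t (i + 1))

theorem row_boundary {i : ℕ} (t : ℕ) (hi : i = 0 ∨ y.length < i) : C.row y t i = C.blank := by
  cases t with
  | succ t => simp [row, hi]
  | zero =>
    rcases hi with rfl | hi
    · rfl
    · obtain ⟨i, rfl⟩ := Nat.exists_eq_succ_of_ne_zero (Nat.ne_zero_of_lt hi)
      simp only [row, initial]
      rw [List.getElem?_eq_none (by omega)]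
      rfl

/-- Renaming of cell contents. -/
def map (ε : S ≃ S') : CellAutomaton S' where
  rule a b c := ε (C.rule (ε.symm a) (ε.symm b) (ε.symm c))
  blank := ε C.blank

theorem row_map (ε : S ≃ S') (t i : ℕ) : (C.map ε).row (y.map ε) t i = ε (C.row y t i) := by
  induction t generalizing i with
  | zero =>
    cases i with
    | zero => rfl
    | succ i =>
      simp only [row, initial, List.getElem?_map, map]
      cases y[i]? <;> rfl
  | succ t ih =>
    simp only [row, List.length_map, ih]
    split_ifs
    · rfl
    · simp [map]

end CellAutomaton

/-! ### An alternating automaton over one letter that traces cells back in time -/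

namespace CellAutomaton

open PosFormula

variable {m : ℕ} (C : CellAutomaton (Fin m)) (target : List (Fin m)) (y : List (Fin m))

/-- The number of the state that expresses that cell `i` contains `s`. -/
def cell (m i s : ℕ) : ℕ := i * m + s + 4

/-- An atom stands for the number of a state, or for this number relative to a cell. -/
def shift (m j : ℕ) : Bool × ℕ → ℕ
  | (false, k) => k
  | (true, k) => j * m + k

/-- The condition, in terms of the previous contents of the cells `0`, `1` and `2`, for the content `s`
of cell `1`. -/
def stepFormula (s : ℕ) : PosFormula (Bool × ℕ) :=
  disj (false, 3) ((List.finRange m).flatMap fun a : Fin m =>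
    (List.finRange m).flatMap fun b : Fin m =>
    ((List.finRange m).filter fun c : Fin m => (C.rule a b c : ℕ) = s).map fun c : Fin m =>
      .and (.atom (true, cell m 0 a)) (.and (.atom (true, cell m 1 b)) (.atom (true, cell m 2 c))))

/-- The transition conditions. State `0` is initial, the states `1` and `2` guess the parity of the
length of the remaining word, and from state `3` nothing is accepted. -/
def trans : ℕ → PosFormula ℕ
  | 0 => .and (disj 3 ((List.range y.length).flatMap fun j =>
      target.map fun s : Fin m => .atom (cell m (j + 1) s))) (.or (.atom 1) (.atom 2))
  | 1 => .atom 2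
  | 2 => .atom 1
  | 3 => .atom 3
  | q + 4 =>
    if q / m = 0 ∨ y.length < q / m then .atom (q + 4)
    else (C.stepFormula (q % m)).map (shift m (q / m - 1))

/-- The accepting states. -/
def IsFinal : ℕ → Prop
  | 0 => False
  | 1 => True
  | 2 => False
  | 3 => False
  | q + 4 => (C.initial y (q / m) : ℕ) = q % m

open Classical in
/-- An alternating automaton over a unary alphabet that accepts the words that are longer than some
time at which a cell has its content in `target`. -/
noncomputable def automaton : AFA (Fin 1) (Fin ((y.length + 2) * m + 4)) where
  init := 0
  δ q _ := (C.trans target y q).map (Fin.ofNat _)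
  final := Finset.univ.filter fun q => C.IsFinal y q

/-- The alternating automaton as an input of a decision problem. -/
noncomputable def toAFA : AFAInstance where
  numLetters := 1
  letters_pos := Nat.one_pos
  numStates := (y.length + 2) * m + 4
  aut := C.automaton target y

theorem cell_lt {i W : ℕ} (hi : i < W + 2) (s : Fin m) : cell m i s < (W + 2) * m + 4 := by
  have := s.2
  have h : (i + 1) * m ≤ (W + 2) * m := Nat.mul_le_mul_right _ hi
  rw [cell]
  linarith

theorem cell_div (i : ℕ) (s : Fin m) : (i * m + s) / m = i := by
  have := s.2
  rw [mul_comm, Nat.mul_add_div (by omega), Nat.div_eq_of_lt this, add_zero]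

theorem cell_mod (i : ℕ) (s : Fin m) : (i * m + s) % m = s := by
  rw [mul_comm, Nat.mul_add_mod, Nat.mod_eq_of_lt s.2]

theorem shift_cell (i j s : ℕ) : shift m j (true, cell m i s) = cell m (j + i) s := by
  simp only [shift, cell]
  ring

theorem trans_cell (i : ℕ) (s : Fin m) : C.trans target y (cell m i s) =
    if i = 0 ∨ y.length < i then .atom (cell m i s)
    else (C.stepFormula s).map (shift m (i - 1)) := by
  rw [cell, trans, cell_div, cell_mod]

/-- Ensures that the reduction modulo the number of states, hidden in `Fin.ofNat`, changes no atom.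
The `+ 2` accounts for the two boundary cells, which are neighbours of cells of the row. -/
theorem all_trans {q : ℕ} (hq : q < (y.length + 2) * m + 4) :
    (C.trans target y q).All (· < (y.length + 2) * m + 4) := by
  match q, hq with
  | 0, _ =>
    refine ⟨(all_disj _ _ _).2 ⟨?_, by omega⟩, ?_, ?_⟩
    · intro φ hφ
      simp only [List.mem_flatMap, List.mem_range, List.mem_map] at hφ
      obtain ⟨j, hj, s, -, rfl⟩ := hφ
      exact cell_lt (by omega) _
    · change 1 < _
      omega
    · change 2 < _
      omega
  | 1, _ => change 2 < _; omega
  | 2, _ => change 1 < _; omega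
  | 3, _ => change 3 < _; omega
  | q + 4, hq =>
    rw [trans]
    split_ifs with h
    · exact hq
    · rw [not_or] at h
      rw [stepFormula, all_map]
      refine (all_disj _ _ _).2 ⟨?_, by simp [shift]⟩
      intro φ hφ
      simp only [List.mem_flatMap, List.mem_map] at hφ
      obtain ⟨a, -, b, -, c, -, rfl⟩ := hφ
      have hi (k : ℕ) (hk : k ≤ 2) : q / m - 1 + k < y.length + 2 := by
        generalize q / m = i at h ⊢
        omega
      simp only [All, shift_cell]
      exact ⟨cell_lt (hi 0 (by omega)) _, cell_lt (hi 1 (by omega)) _, cell_lt (hi 2 le_rfl) _⟩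

section

variable (w : List (Fin 1))

/-- Acceptance by a state that is given as a number. -/
def AcceptsAt (w : List (Fin 1)) (k : ℕ) : Prop :=
  (C.automaton target y).Accepts w (Fin.ofNat (n := (y.length + 2) * m + 4) k)

open Classical in
theorem acceptsAt_nil {k : ℕ} (hk : k < (y.length + 2) * m + 4) :
    C.AcceptsAt target y [] k ↔ C.IsFinal y k := by
  rw [AcceptsAt, AFA.Accepts]
  refine (Finset.mem_filter.trans (and_iff_right (Finset.mem_univ _))).trans ?_
  rw [Fin.val_ofNat, Nat.mod_eq_of_lt hk]

theorem acceptsAt_cons (a : Fin 1) {k : ℕ} (hk : k < (y.length + 2) * m + 4) :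
    C.AcceptsAt target y (a :: w) k ↔ (C.trans target y k).Sat (C.AcceptsAt target y w) := by
  rw [AcceptsAt, AFA.Accepts]
  refine (sat_map _ _ _).trans ?_
  rw [Fin.val_ofNat, Nat.mod_eq_of_lt hk]
  rfl

theorem acceptsAt_dead : ¬ C.AcceptsAt target y w 3 := by
  induction w with
  | nil => exact fun h => (C.acceptsAt_nil target y (by omega)).1 h
  | cons a w ih => exact fun h => ih ((C.acceptsAt_cons target y w a (by omega)).1 h)

theorem acceptsAt_parity : (C.AcceptsAt target y w 1 ↔ Even w.length) ∧
    (C.AcceptsAt target y w 2 ↔ ¬ Even w.length) := by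
  induction w with
  | nil =>
    rw [C.acceptsAt_nil target y (by omega), C.acceptsAt_nil target y (by omega)]
    simp [IsFinal]
  | cons a w ih =>
    rw [C.acceptsAt_cons target y w a (by omega), C.acceptsAt_cons target y w a (by omega),
      List.length_cons, Nat.even_add_one, not_not]
    exact ⟨ih.2, ih.1⟩

/-- State `3` only replaces the constant "false", which positive formulas lack, so it drops out of
the disjunction. -/
theorem sat_stepFormula (v : ℕ → Prop) (j s : ℕ) (hv : ¬ v 3) :
    ((C.stepFormula s).map (shift m j)).Sat v ↔ ∃ a b c : Fin m, (C.rule a b c : ℕ) = s ∧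
      v (cell m j a) ∧ v (cell m (j + 1) b) ∧ v (cell m (j + 2) c) := by
  rw [sat_map, stepFormula, sat_disj]
  rw [show shift m j (false, 3) = 3 from rfl, or_iff_left hv]
  constructor
  · rintro ⟨φ, hφ, h⟩
    simp only [List.mem_flatMap, List.mem_map, List.mem_filter, decide_eq_true_eq] at hφ
    obtain ⟨a, -, b, -, c, ⟨-, hc⟩, rfl⟩ := hφ
    simp only [Sat, shift_cell, add_zero] at h
    exact ⟨a, b, c, hc, h⟩
  · rintro ⟨a, b, c, hc, h⟩
    refine ⟨.and (.atom (true, cell m 0 a))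
      (.and (.atom (true, cell m 1 b)) (.atom (true, cell m 2 c))), ?_, ?_⟩
    · simp only [List.mem_flatMap, List.mem_map, List.mem_filter, decide_eq_true_eq]
      exact ⟨a, List.mem_finRange a, b, List.mem_finRange b, c, ⟨List.mem_finRange c, hc⟩, rfl⟩
    · simpa only [Sat, shift_cell, add_zero] using h

/-- Reading a letter goes one step back in time. By induction each of the three guessed contents is
accepted only if it is the true one, so the rule applied to them gives the true next content.
Boundary cells have constant content and loop; with no letters left, acceptance is a comparison with
the initial row. -/
theorem acceptsAt_cell {i : ℕ} (hi : i < y.length + 2) (s : Fin m) :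
    C.AcceptsAt target y w (cell m i s) ↔ C.row y w.length i = s := by
  induction w generalizing i s with
  | nil =>
    rw [acceptsAt_nil _ _ _ (cell_lt hi s), cell, IsFinal, cell_div, cell_mod, ← Fin.ext_iff]
    rfl
  | cons a w ih =>
    rw [acceptsAt_cons _ _ _ _ _ (cell_lt hi s), trans_cell]
    by_cases hb : i = 0 ∨ y.length < i
    · rw [if_pos hb, Sat, ih hi, row_boundary _ _ _ hb, row_boundary _ _ _ hb]
    · rw [if_neg hb, sat_stepFormula _ _ _ _ (C.acceptsAt_dead target y w), List.length_cons, row,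
        if_neg hb]
      have h1 : i - 1 + 1 = i := by omega
      have h2 : i - 1 + 2 = i + 1 := by omega
      rw [h1, h2]
      constructor
      · rintro ⟨a, b, c, hs, ha, hb, hc⟩
        rw [ih (by omega)] at ha hb hc
        rw [ha, hb, hc]
        exact Fin.ext hs
      · intro h
        exact ⟨_, _, _, congrArg Fin.val h, (ih (by omega) _).2 rfl, (ih (by omega) _).2 rfl,
          (ih (by omega) _).2 rfl⟩

/-- The parity conjunct always holds, by excluded middle. The first letter is spent on leaving the
initial state, so time `t` corresponds to length `t + 1`. -/
theorem accepts_init_iff :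
    (C.automaton target y).Accepts w (C.automaton target y).init ↔
      ∃ (a : Fin 1) (w' : List (Fin 1)), w = a :: w' ∧
        ∃ i < y.length, C.row y w'.length (i + 1) ∈ target := by
  have h0 : (C.automaton target y).Accepts w (C.automaton target y).init ↔
    C.AcceptsAt target y w 0 := Iff.rfl
  rw [h0]
  cases w with
  | nil => simp [acceptsAt_nil, IsFinal]
  | cons a w =>
    rw [acceptsAt_cons _ _ _ _ _ (by omega), trans, Sat, sat_disj, Sat, Sat, Sat,
      (C.acceptsAt_parity target y w).1, (C.acceptsAt_parity target y w).2]
    simp only [em, and_true, C.acceptsAt_dead target y w, or_false]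
    constructor
    · rintro ⟨φ, hφ, h⟩
      simp only [List.mem_flatMap, List.mem_range, List.mem_map] at hφ
      obtain ⟨j, hj, s, hs, rfl⟩ := hφ
      rw [Sat, acceptsAt_cell _ _ _ _ (by omega)] at h
      exact ⟨a, w, rfl, j, hj, h ▸ hs⟩
    · rintro ⟨a, w', hw, j, hj, h⟩
      obtain ⟨-, rfl⟩ := List.cons.inj hw
      refine ⟨.atom (cell m (j + 1) (C.row y w.length (j + 1))), ?_, ?_⟩
      · simp only [List.mem_flatMap, List.mem_range, List.mem_map]
        exact ⟨j, hj, _, h, rfl⟩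
      · exact (C.acceptsAt_cell target y w (by omega) _).2 rfl

end

/-- Eve has to guess the parity of the length of the word, and therefore loses her letter game on
every automaton `automaton` that accepts all long enough words. -/
theorem isExistsGFG_automaton_iff (h : ∀ s ∈ target, ∀ a b, C.rule a s b = s) :
    (C.automaton target y).IsExistsGFG ↔ ∀ t, ∀ i < y.length, C.row y t (i + 1) ∉ target := by
  constructor
  · rintro ⟨σ, hσ⟩ t i hi ht
    -- Stability provides accepted words of two consecutive lengths.
    have later : C.row y (t + 1) (i + 1) ∈ target := by
      rw [row, if_neg (by omega), h _ ht]
      exact ht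
    let A := (C.automaton target y)
    let st (k : ℕ) : Fin ((y.length + 2) * m + 4) := Fin.ofNat _ k
    have hval (k : ℕ) (hk : k < 4) : (st k : ℕ) = k := by
      rw [Fin.val_ofNat, Nat.mod_eq_of_lt (by omega)]
    have hδ (k : ℕ) (hk : k < 4) : A.δ (st k) 0 = (C.trans target y k).map (Fin.ofNat _) := by
      change (C.trans target y (st k)).map _ = _
      rw [hval k hk]
    have lang (n : ℕ) (hn : C.row y n (i + 1) ∈ target) :
        List.replicate (n + 1) (0 : Fin 1) ∈ A.language :=
      AFA.mem_language_iff.2 ((C.accepts_init_iff target y _).2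
        ⟨0, List.replicate n 0, rfl, i, hi, by rwa [List.length_replicate]⟩)
    -- Adam chooses the parity conjunct, and `σ` commits to a guess `k` after a single letter.
    have first : ∃ k, (k = 1 ∨ k = 2) ∧ ∃ h, A.Play σ h [0] (.atom (st k)) := by
      have h1 := ((AFA.Play.start (A := A) (σ := σ)).letter 0)
      have h2 : A.δ A.init 0 = (C.trans target y 0).map (Fin.ofNat _) := hδ 0 (by omega)
      rw [h2] at h1
      have h3 := (h1.adam true).eve
      cases hb : σ ([] ++ [Sum.inl 0] ++ [Sum.inr true]) <;> rw [hb] at h3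
      · exact ⟨1, Or.inl rfl, _, h3⟩
      · exact ⟨2, Or.inr rfl, _, h3⟩
    obtain ⟨k, hk, h', hp⟩ := first
    -- From here on nobody has a choice: the states `1` and `2`, that is `k` and `3 - k`, alternate.
    have loop (n : ℕ) : ∃ h, A.Play σ h (List.replicate (n + 1) 0)
        (.atom (st (if Even n then k else 3 - k))) := by
      induction n with
      | zero => exact ⟨h', by simpa using hp⟩
      | succ n ih =>
        obtain ⟨h'', hp'⟩ := ih
        have h2 := hp'.letter 0
        rw [hδ _ (by split_ifs <;> omega)] at h2
        refine ⟨h'' ++ [Sum.inl 0], ?_⟩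
        · rw [List.replicate_succ']
          convert h2 using 1
          simp only [Nat.even_add_one]
          rcases hk with rfl | rfl <;> by_cases hn : Even n <;> simp [hn, trans, PosFormula.map, st]
    have final (n : ℕ) (hn : C.row y n (i + 1) ∈ target) :
        (if Even n then k else 3 - k) = 1 := by
      obtain ⟨h'', hp'⟩ := loop n
      classical
      have h1 := (hσ _ _ _ hp').resolve_left (not_not.2 (lang n hn))
      have h2 : C.IsFinal y (st (if Even n then k else 3 - k)) := (Finset.mem_filter.1 h1).2
      rw [hval _ (by split_ifs <;> omega)] at h2
      by_contra h3
      have h4 : (if Even n then k else 3 - k) = 2 := by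
        split_ifs at h3 ⊢ <;> omega
      rw [h4] at h2
      exact h2
    -- Stopping at time `t` and at time `t + 1` would require both `k` and `3 - k` to be `1`.
    have h1 := final t ht
    have h2 := final (t + 1) later
    simp only [Nat.even_add_one] at h2
    by_cases hn : Even t <;> simp only [hn, not_true, not_false_eq_true, if_true, if_false] at h1 h2 <;>
      omega
  · intro hn
    refine AFA.isExistsGFG_of_forall_not_accepts fun w hw => ?_
    obtain ⟨a, w', -, i, hi, h'⟩ := (C.accepts_init_iff target y w).1 hw
    exact hn _ i hi h'

end CellAutomaton

/-! ### Space-bounded Turing machines as cellular automata -/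

namespace SpaceBounded

open Turing

variable {Γ Λ : Type} [Inhabited Γ] [Inhabited Λ] (M : TM0.Machine Γ Λ)

/-- The content of a cell: a tape symbol and, if the head is there, the state of the machine. The
content `none` marks the cell from which the head enters the tape. -/
abbrev Cell (Γ Λ : Type) : Type := Option (Γ × Option Λ)

/-- The state in which the head enters a cell from its right neighbour. -/
def enterLeft : Cell Γ Λ → Option Λ
  | some (a, some q) =>
    match M q a with
    | some (q', .move .left) => some q'
    | _ => none
  | _ => none

/-- The state in which the head enters a cell from its left neighbour. -/
def enterRight : Cell Γ Λ → Option Λ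
  | none => some default
  | some (a, some q) =>
    match M q a with
    | some (q', .move .right) => some q'
    | _ => none
  | _ => none

/-- The local rule that describes the steps of the machine. -/
def localRule (l c r : Cell Γ Λ) : Cell Γ Λ :=
  match c with
  | none => some (default, none)
  | some (a, none) => some (a, (enterRight M l).or (enterLeft M r))
  | some (a, some q) =>
    match M q a with
    | none => some (a, some q)
    | some (q', .write b) => some (b, some q')
    | some (_, .move _) => some (a, none)

/-- One step of the machine, with the position of the head; a halting machine stands still. -/
def stepPos (c : TM0.Cfg Γ Λ × ℤ) : TM0.Cfg Γ Λ × ℤ :=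
  match M c.1.q c.1.Tape.head with
  | none => c
  | some (q, .write b) => (⟨q, c.1.Tape.write b⟩, c.2)
  | some (q, .move .left) => (⟨q, c.1.Tape.move .left⟩, c.2 - 1)
  | some (q, .move .right) => (⟨q, c.1.Tape.move .right⟩, c.2 + 1)

/-- The content of the cell at position `z`. -/
def view (c : TM0.Cfg Γ Λ × ℤ) (z : ℤ) : Cell Γ Λ :=
  some (c.1.Tape.nth (z - c.2), if z = c.2 then some c.1.q else none)

/-- In absolute coordinates the tape does not move: the shift of the tape cancels the change of the
head position, and only the cell under the head is written. -/
theorem nth_stepPos (c : TM0.Cfg Γ Λ × ℤ) {z : ℤ} (hz : z ≠ c.2) :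
    (stepPos M c).1.Tape.nth (z - (stepPos M c).2) = c.1.Tape.nth (z - c.2) := by
  unfold stepPos
  have : z - c.2 ≠ 0 := sub_ne_zero.2 hz
  split
  · rfl
  · simp [this]
  · rw [Tape.move_left_nth]
    congr 1
    ring
  · rw [Tape.move_right_nth]
    congr 1
    ring

omit [Inhabited Λ] in
theorem view_of_ne {c : TM0.Cfg Γ Λ × ℤ} {z : ℤ} (hz : z ≠ c.2) :
    view c z = some (c.1.Tape.nth (z - c.2), none) := by
  rw [view, if_neg hz]

omit [Inhabited Λ] in
theorem view_self (c : TM0.Cfg Γ Λ × ℤ) : view c c.2 = some (c.1.Tape.head, some c.1.q) := by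
  simp [view]

theorem view_stepPos (c : TM0.Cfg Γ Λ × ℤ) (z : ℤ) :
    view (stepPos M c) z = localRule M (view c (z - 1)) (view c z) (view c (z + 1)) := by
  by_cases hz : z = c.2
  · subst hz
    rw [view_self, localRule]
    unfold view stepPos
    rcases hM : M c.1.q c.1.Tape.head with _ | ⟨q', (_ | _) | b⟩ <;> (simp [Tape.write]; try omega)
  -- Away from the head the symbol is kept. It remains to see whether the head arrives, which
  -- depends on whether it is at the left neighbour, at the right one, or at neither.
  · rw [view, nth_stepPos M c hz, view_of_ne hz, localRule]
    congr 2
    by_cases hl : z - 1 = c.2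
    · have hr : z + 1 ≠ c.2 := by omega
      rw [hl, view_self, view_of_ne hr]
      unfold stepPos
      rcases hM : M c.1.q c.1.Tape.head with _ | ⟨q', (_ | _) | b⟩ <;>
        simp [enterLeft, enterRight, hM] <;> omega
    · rw [view_of_ne hl]
      by_cases hr : z + 1 = c.2
      · rw [hr, view_self]
        unfold stepPos
        rcases hM : M c.1.q c.1.Tape.head with _ | ⟨q', (_ | _) | b⟩ <;>
          simp [enterLeft, enterRight, hM] <;> omega
      · rw [view_of_ne hr]
        unfold stepPos
        rcases hM : M c.1.q c.1.Tape.head with _ | ⟨q', (_ | _) | b⟩ <;>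
          simp [enterLeft, enterRight] <;> omega

/-- Carries the space bound over to all iterates of `stepPos`, including those after halting. -/
theorem headReaches_stepPos {c₀ : TM0.Cfg Γ Λ} {c : TM0.Cfg Γ Λ × ℤ}
    (h : HeadReaches M c₀ c.1 c.2) : HeadReaches M c₀ (stepPos M c).1 (stepPos M c).2 := by
  obtain ⟨⟨q, T⟩, z⟩ := c
  have key : ∀ q' s, M q T.head = some (q', s) → HeadReaches M c₀ ⟨q', match s with
      | .move d => T.move d
      | .write a => T.write a⟩ (z + headMove M ⟨q, T⟩) := fun q' s hs =>
    h.step (by simp only [TM0.step, hs]; rfl)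
  unfold stepPos
  split
  · exact h
  all_goals
    rename_i hM
    have := key _ _ hM
    simpa [headMove, hM, sub_eq_add_neg] using this

theorem exists_iterate_of_reaches {c c' : TM0.Cfg Γ Λ} (h : TM0.Reaches M c c') (z : ℤ) :
    ∃ t, ((stepPos M)^[t] (c, z)).1 = c' := by
  induction h with
  | refl => exact ⟨0, rfl⟩
  | tail _ hs ih =>
    obtain ⟨t, ht⟩ := ih
    refine ⟨t + 1, ?_⟩
    rw [Function.iterate_succ_apply']
    generalize (stepPos M)^[t] (c, z) = d at ht
    subst ht
    obtain ⟨⟨q, T⟩, z⟩ := d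
    obtain ⟨⟨q', s⟩, hM, rfl⟩ := Option.map_eq_some_iff.1 hs
    replace hM : M q T.head = some (q', s) := hM
    unfold stepPos
    rcases s with (_ | _) | _ <;> simp [hM]

/-- The automaton that simulates the machine. -/
def cellAutomaton : CellAutomaton (Cell Γ Λ) where
  rule := localRule M
  blank := some (default, none)

theorem nth_mk₁_eq_default (l : List Γ) {z : ℤ} (hz : z < 0 ∨ l.length ≤ z) :
    (Tape.mk₁ l).nth z = default := by
  match z, hz with
  | (n : ℕ), hz =>
    rw [Tape.mk₁, Tape.mk₂, Tape.mk'_nth_nat, ListBlank.nth_mk, List.getI_eq_default]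
    omega
  | Int.negSucc n, _ =>
    change (ListBlank.mk []).nth n = default
    simp

/-- The initial row of cells. -/
def initialRow (P : ℕ) (l : List Γ) : List (Cell Γ Λ) :=
  paddedRow (some (default, none)) none P (l.map fun a => some (a, none))

omit [Inhabited Λ] in
theorem length_initialRow (P : ℕ) (l : List Γ) :
    (initialRow P l : List (Cell Γ Λ)).length = P + 1 + l.length + P := by
  simp [initialRow, paddedRow]
  ring

/-- Cell `0` is the boundary, followed by `P` blanks and the mark; hence tape position `z` is cell
`z + P + 2`, and the mark sits at position `-1`. -/
theorem initial_initialRow (P : ℕ) (l : List Γ) (i : ℕ) :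
    (cellAutomaton M).initial (initialRow P l) i =
      if i = P + 1 then none else some ((Tape.mk₁ l).nth (i - (P + 2)), none) := by
  cases i with
  | zero =>
    rw [if_neg (by omega), nth_mk₁_eq_default _ (by omega)]
    rfl
  | succ i =>
    rw [CellAutomaton.initial, initialRow, paddedRow]
    rcases lt_trichotomy i P with h | rfl | h
    · rw [List.getElem?_append_left (by simpa using h), List.getElem?_replicate, if_pos h,
        if_neg (by omega), nth_mk₁_eq_default _ (by omega)]
      rfl
    · simp
    · obtain ⟨j, rfl⟩ : ∃ j, i = P + 1 + j := ⟨i - (P + 1), by omega⟩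
      rw [List.getElem?_append_right (by simp; omega), List.length_replicate, if_neg (by omega),
        show P + 1 + j - P = j + 1 by omega, List.getElem?_cons_succ,
        show ((P + 1 + j + 1 : ℕ) : ℤ) - (P + 2) = (j : ℕ) by push_cast; ring]
      by_cases hj : j < l.length
      · rw [List.getElem?_append_left (by simpa using hj), Tape.mk₁, Tape.mk₂, Tape.mk'_nth_nat,
          ListBlank.nth_mk, List.getI_eq_getElem _ hj]
        simp [hj]
      · rw [nth_mk₁_eq_default _ (by omega), List.getElem?_append_right (by simpa using hj),
          List.getElem?_replicate]
        split_ifs <;> rfl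

section

variable {M} {l : List Γ} {P : ℕ}
  (hP : ∀ (c : TM0.Cfg Γ Λ) (z : ℤ), HeadReaches M (TM0.init l) c z → z.natAbs < P)

include hP

theorem natAbs_iterate_lt (t : ℕ) : ((stepPos M)^[t] (TM0.init l, 0)).2.natAbs < P := by
  refine hP ((stepPos M)^[t] (TM0.init l, 0)).1 _ ?_
  induction t with
  | zero => exact .refl
  | succ t ih =>
    rw [Function.iterate_succ_apply']
    exact headReaches_stepPos M ih

/-- The head never gets there, so the initial blank survives. This justifies the constant boundary
of the cellular automaton. -/
theorem view_iterate_outside (t : ℕ) {z : ℤ} (hz : z < -P - 1 ∨ l.length + P ≤ z) :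
    view ((stepPos M)^[t] (TM0.init l, 0)) z = some (default, none) := by
  have hne (t : ℕ) : z ≠ ((stepPos M)^[t] (TM0.init l, 0)).2 := by
    have := natAbs_iterate_lt hP t
    omega
  rw [view_of_ne (hne t)]
  congr 2
  induction t with
  | zero =>
    refine (congrArg _ (sub_zero z)).trans (nth_mk₁_eq_default l ?_)
    omega
  | succ t ih => rw [Function.iterate_succ_apply', nth_stepPos M _ (hne t), ih]

/-- The cellular automaton is one step late: its first step turns the mark into a blank and puts the
head, in the initial state, on position `0`. This keeps the state of the machine out of the initial
row, which can thus be written down from the input symbol by symbol. -/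
theorem row_cellAutomaton (t i : ℕ) :
    (cellAutomaton M).row (initialRow P l) (t + 1) i =
      view ((stepPos M)^[t] (TM0.init l, 0)) (i - (P + 2)) := by
  induction t generalizing i with
  | zero =>
    by_cases hi : i = 0 ∨ (initialRow P l : List (Cell Γ Λ)).length < i
    · rw [CellAutomaton.row_boundary _ _ _ hi, view_iterate_outside hP]
      · rfl
      · rw [length_initialRow] at hi
        omega
    · rw [CellAutomaton.row, if_neg hi]
      simp only [CellAutomaton.row, initial_initialRow]
      rw [not_or] at hi
      have h1 : i - 1 ≠ P + 1 ∨ i = P + 2 := by omega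
      change localRule M _ _ _ = view (TM0.init l, 0) _
      rcases eq_or_ne i (P + 1) with rfl | h2
      · rw [if_pos rfl, view_of_ne (by push_cast; simp)]
        simp only [localRule]
        rw [TM0.init, nth_mk₁_eq_default _ (by push_cast; omega)]
      · rw [if_neg h2]
        rcases eq_or_ne i (P + 2) with rfl | h3
        · simp [localRule, view, enterRight, TM0.init]
        · rw [if_neg (by omega), view_of_ne (by simp only; omega)]
          by_cases h4 : i + 1 = P + 1 <;>
            simp [localRule, enterRight, enterLeft, h4, TM0.init]
  | succ t ih =>
    by_cases hi : i = 0 ∨ (initialRow P l : List (Cell Γ Λ)).length < i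
    · rw [CellAutomaton.row_boundary _ _ _ hi, view_iterate_outside hP]
      · rfl
      · rw [length_initialRow] at hi
        omega
    · rw [CellAutomaton.row, if_neg hi, ih, ih, ih, Function.iterate_succ_apply', view_stepPos]
      have h1 : ((i - 1 : ℕ) : ℤ) - (P + 2) = i - (P + 2) - 1 := by omega
      have h2 : ((i + 1 : ℕ) : ℤ) - (P + 2) = i - (P + 2) + 1 := by omega
      rw [h1, h2]
      rfl

end

theorem stepPos_eq_self {c : TM0.Cfg Γ Λ × ℤ} (h : M c.1.q c.1.Tape.head = none) :
    stepPos M c = c := by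
  simp [stepPos, h]

/-- The contents of cells at which the machine has halted in a state that is not accepting. -/
def rejecting (acc : Set Λ) : Set (Cell Γ Λ) :=
  {s | ∃ a q, s = some (a, some q) ∧ M q a = none ∧ q ∉ acc}

theorem rule_rejecting {acc : Set Λ} {s : Cell Γ Λ} (hs : s ∈ rejecting M acc) (a b : Cell Γ Λ) :
    (cellAutomaton M).rule a s b = s := by
  obtain ⟨c, q, rfl, h, -⟩ := hs
  simp [cellAutomaton, localRule, h]

theorem mem_iff_not_rejecting {l : List Γ} {P : ℕ} {acc : Set Λ} {p : Prop}
    (hP : ∀ (c : TM0.Cfg Γ Λ) (z : ℤ), HeadReaches M (TM0.init l) c z → z.natAbs < P)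
    (h : ∃ c : TM0.Cfg Γ Λ, TM0.Reaches M (TM0.init l) c ∧ TM0.step M c = none ∧ (c.q ∈ acc ↔ p)) :
    p ↔ ∀ t, ∀ i < (initialRow P l : List (Cell Γ Λ)).length,
      (cellAutomaton M).row (initialRow P l) t (i + 1) ∉ rejecting M acc := by
  obtain ⟨c, hc, hs, hp⟩ := h
  obtain ⟨t₀, ht₀⟩ := exists_iterate_of_reaches M hc 0
  set f := fun t => (stepPos M)^[t] (TM0.init l, (0 : ℤ)) with hf
  have hhalt : M (f t₀).1.q (f t₀).1.Tape.head = none := by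
    change (f t₀).1 = c at ht₀
    rw [ht₀]
    exact Option.map_eq_none_iff.1 hs
  rw [← hp, ← ht₀]
  have stay {t : ℕ} (h : M (f t).1.q (f t).1.Tape.head = none) (k : ℕ) : f (t + k) = f t := by
    simp only [hf] at h ⊢
    rw [add_comm, Function.iterate_add_apply]
    exact Function.iterate_fixed (stepPos_eq_self M h) k
  constructor
  · rintro hacc t i hi ⟨a, q, ha, hM, hq⟩
    cases t with
    -- Before the first step no cell contains the head.
    | zero =>
      rw [CellAutomaton.row, initial_initialRow] at ha
      split_ifs at ha
      simp at ha
    | succ t =>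
      rw [row_cellAutomaton hP] at ha
      obtain ⟨h1, h2⟩ := Prod.mk.inj (Option.some.inj ha)
      split_ifs at h2 with h3
      rw [h3, sub_self, Tape.nth_zero] at h1
      have hq' : (f t).1.q = q := Option.some.inj h2
      rw [← hq', ← h1] at hM
      -- A halted configuration is never left, so those at times `t` and `t₀` both equal the one at
      -- time `t + t₀`.
      have h4 := stay hM t₀
      have h5 := stay hhalt t
      rw [add_comm, h5] at h4
      rw [← hq', ← h4] at hq
      exact hq hacc
  · intro hn
    by_contra hacc
    have hlt : (f t₀).2.natAbs < P := natAbs_iterate_lt hP t₀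
    have hrow := row_cellAutomaton hP t₀ ((f t₀).2 + P + 2).toNat
    change _ = view (f t₀) _ at hrow
    rw [show ((((f t₀).2 + P + 2).toNat : ℕ) : ℤ) - (P + 2) = (f t₀).2 by omega, view_self] at hrow
    refine hn (t₀ + 1) (((f t₀).2 + P + 2).toNat - 1) ?_ ?_
    · rw [length_initialRow]
      omega
    · rw [show ((f t₀).2 + P + 2).toNat - 1 + 1 = ((f t₀).2 + P + 2).toNat by omega, hrow]
      exact ⟨_, _, rfl, hhalt, hacc⟩

end SpaceBounded

/-- Bounds of this shape are the ones `RowStack.power` can produce. Since `n + 1` is positive,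
larger exponents only help, so for a sum it suffices to add coefficients and exponents. -/
theorem Polynomial.exists_eval_le (p : Polynomial ℕ) : ∃ m d : ℕ, ∀ n, p.eval n ≤ m * (n + 1) ^ d := by
  induction p using Polynomial.induction_on' with
  | monomial d m =>
    refine ⟨m, d, fun n => ?_⟩
    rw [Polynomial.eval_monomial]
    gcongr
    omega
  | add p q hp hq =>
    obtain ⟨m, d, h⟩ := hp
    obtain ⟨m', d', h'⟩ := hq
    refine ⟨m + m', d + d', fun n => ?_⟩
    rw [Polynomial.eval_add, add_mul]
    refine add_le_add ((h n).trans ?_) ((h' n).trans ?_)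
    · gcongr <;> omega
    · gcongr <;> omega

open SpaceBounded in
/-- Languages in PSPACE are decided by cellular automata on rows of polynomial length. -/
theorem InPSPACE.exists_cellAutomaton {I : Type} {L : Language I} (hL : InPSPACE L) :
    ∃ (m : ℕ) (C : CellAutomaton (Fin m)) (target : List (Fin m)) (blank star : Fin m)
      (e : I → Fin m) (k d : ℕ), (∀ s ∈ target, ∀ a b, C.rule a s b = s) ∧
      ∀ (x : List I) (y : List (Fin m)),
        y = paddedRow blank star (k * (x.length + 1) ^ d) (x.map e) →
        (x ∈ L ↔ ∀ t, ∀ i < y.length, C.row y t (i + 1) ∉ target) := by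
  classical
  obtain ⟨Γ, Λ, _, _, _, _, M, acc, e, p, -, h⟩ := hL
  have := Fintype.ofFinite (Cell Γ Λ)
  -- The `+ 1` makes the space bound strict: with empty input, position `P` would already lie
  -- outside the row.
  obtain ⟨k, d, hkd⟩ := (p + 1).exists_eval_le
  let ε := Fintype.equivFin (Cell Γ Λ)
  let target := (Finset.univ.filter fun s => ε.symm s ∈ rejecting M acc).toList
  have mem_target (s : Cell Γ Λ) : ε s ∈ target ↔ s ∈ rejecting M acc := by simp [target]
  refine ⟨_, (cellAutomaton M).map ε, target, ε (some (default, none)), ε none,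
    fun i => ε (some (e i, none)), k, d, ?_, ?_⟩
  · intro s hs a b
    obtain ⟨s, rfl⟩ := ε.surjective s
    rw [mem_target] at hs
    simp [CellAutomaton.map, rule_rejecting M hs]
  · intro x y hy
    have hy' : y = (initialRow (k * (x.length + 1) ^ d) (x.map e) : List (Cell Γ Λ)).map ε := by
      rw [hy]
      simp [initialRow, paddedRow]
    subst hy'
    simp only [CellAutomaton.row_map, mem_target, List.length_map]
    refine mem_iff_not_rejecting M (fun c z hz => ?_) (h x).1
    have h1 := (h x).2 c z hz
    have h2 := hkd x.length
    simp only [Polynomial.eval_add, Polynomial.eval_one] at h2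
    omega

/-! ### Writing down the alternating automaton -/

namespace CellAutomaton

open PosFormula AFAInstance AFASymbol TemplateToken

variable {m : ℕ}

/-- Formulas in prefix notation, with the atoms given as numbers. -/
def encodeNat : PosFormula ℕ → List AFASymbol
  | .atom q => encodeNumber q
  | .and φ ψ => conj :: (encodeNat φ ++ encodeNat ψ)
  | .or φ ψ => disj :: (encodeNat φ ++ encodeNat ψ)

theorem encodeFormula_map_ofNat {n : ℕ} [NeZero n] {φ : PosFormula ℕ} (h : φ.All (· < n)) :
    encodeFormula (φ.map (Fin.ofNat n)) = encodeNat φ := by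
  induction φ with
  | atom q => exact congrArg encodeNumber (Nat.mod_eq_of_lt h)
  | and φ ψ ih ih' => simp only [PosFormula.map, encodeFormula, encodeNat, ih h.1, ih' h.2]
  | or φ ψ ih ih' => simp only [PosFormula.map, encodeFormula, encodeNat, ih h.1, ih' h.2]

theorem encodeNat_disj (e : ℕ) (l : List (PosFormula ℕ)) :
    encodeNat (PosFormula.disj e l) =
      l.flatMap (fun φ => AFASymbol.disj :: encodeNat φ) ++ encodeNumber e := by
  induction l with
  | nil => rfl
  | cons φ l ih =>
    simp only [PosFormula.disj, List.foldr_cons] at ih ⊢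
    simp [encodeNat, ih]

/-- The token for a symbol. -/
abbrev token (c : AFASymbol) : TemplateToken (Fin m) AFASymbol := .sym fun _ => c

/-- The template for the number of an atom. -/
def numberTokens : Bool × ℕ → List (TemplateToken (Fin m) AFASymbol)
  | (b, k) => (bif b then [block (List.replicate m tick)] else []) ++
      (List.replicate k (token tick) ++ [token sep])

/-- In unary, `j * m + k` consists of `m` ticks for each of the `j` cells before the current one,
and `k` more. So one template with relative atoms serves all cells. -/
theorem expand_numberTokens (j : ℕ) (a : Option (Fin m)) (k : Bool × ℕ) :
    (numberTokens k).flatMap (expand j a) = encodeNumber (shift m j k) := by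
  have h (k : ℕ) : (List.replicate k (token (m := m) tick) ++ [token sep]).flatMap (expand j a) =
      encodeNumber k := by
    induction k with
    | zero => rfl
    | succ k ih =>
      rw [List.replicate_succ, List.cons_append, List.flatMap_cons, ih]
      rfl
  obtain ⟨_ | _, k⟩ := k
  · exact h k
  · rw [numberTokens, List.flatMap_append, h, cond_true, List.flatMap_singleton]
    simp [expand, encodeNumber, shift, ← List.append_assoc]

/-- The template for a formula. -/
def formulaTokens : PosFormula (Bool × ℕ) → List (TemplateToken (Fin m) AFASymbol)
  | .atom k => numberTokens k
  | .and φ ψ => token conj :: (formulaTokens φ ++ formulaTokens ψ)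
  | .or φ ψ => token disj :: (formulaTokens φ ++ formulaTokens ψ)

theorem expand_formulaTokens (j : ℕ) (a : Option (Fin m)) (φ : PosFormula (Bool × ℕ)) :
    (formulaTokens φ).flatMap (expand j a) = encodeNat (φ.map (shift m j)) := by
  induction φ with
  | atom k => exact expand_numberTokens j a k
  | and φ ψ ih ih' =>
    simp [formulaTokens, ih, ih', encodeNat, PosFormula.map, TemplateToken.expand]
  | or φ ψ ih ih' =>
    simp [formulaTokens, ih, ih', encodeNat, PosFormula.map, TemplateToken.expand]

variable (C : CellAutomaton (Fin m)) (target : List (Fin m)) (y : List (Fin m))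

/-- The template for the flags of the states of a cell. -/
def flagTokens : List (TemplateToken (Fin m) AFASymbol) :=
  (List.finRange m).map fun s => .sym fun a => if a.getD C.blank = s then yes else no

/-- The numbers of letters and of states. -/
def sizeTemplate : RowTemplate (Fin m) AFASymbol where
  pre := [token tick, token sep]
  body := []
  post := numberTokens (true, 2 * m + 4)

/-- The initial state and the accepting states. -/
def flagTemplate : RowTemplate (Fin m) AFASymbol where
  pre := [token sep, token no, token yes, token no, token no] ++ C.flagTokens
  body := C.flagTokens
  post := C.flagTokens

/-- The transition conditions up to those of the left boundary cell. -/
def initTemplate : RowTemplate (Fin m) AFASymbol where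
  pre := [token conj]
  body := target.flatMap fun s : Fin m => token disj :: numberTokens (true, cell m 1 s)
  post := formulaTokens (.atom (false, 3)) ++
    (formulaTokens (.or (.atom (false, 1)) (.atom (false, 2))) ++
    (formulaTokens (.atom (false, 2)) ++ (formulaTokens (.atom (false, 1)) ++
    (formulaTokens (.atom (false, 3)) ++
      (List.finRange m).flatMap fun s : Fin m => numberTokens (false, cell m 0 s)))))

/-- The other transition conditions. -/
def cellTemplate : RowTemplate (Fin m) AFASymbol where
  pre := []
  body := (List.finRange m).flatMap fun s : Fin m => formulaTokens (C.stepFormula s)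
  post := (List.finRange m).flatMap fun s : Fin m => numberTokens (true, cell m 1 s)

theorem flatMap_zipIdx_snd {α β : Type} (l : List α) (g : ℕ → List β) :
    (l.zipIdx.flatMap fun c => g c.2) = (List.range l.length).flatMap g := by
  rw [List.range_eq_range', ← List.zipIdx_map_snd, List.flatMap_map]

theorem flatMap_finRange {β : Type} (n : ℕ) (g : ℕ → List β) :
    ((List.finRange n).flatMap fun q : Fin n => g q) = (List.range n).flatMap g := by
  rw [← List.map_coe_finRange_eq_range, List.flatMap_map]

theorem flatMap_range_mul {β : Type} (n m : ℕ) (g : ℕ → List β) :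
    (List.range (n * m)).flatMap g =
      (List.range n).flatMap fun i => (List.finRange m).flatMap fun s : Fin m => g (i * m + s) := by
  induction n with
  | zero => simp
  | succ n ih =>
    rw [Nat.succ_mul, List.range_add, List.flatMap_append, ih, List.range_succ, List.flatMap_append,
      List.flatMap_singleton, flatMap_finRange m fun s => g (n * m + s), List.flatMap_map]

/-- Splits the states in the order in which templates write them: special states and left boundary,
then the cells of the row, then the right boundary. -/
theorem flatMap_states {β : Type} (W : ℕ) (g : ℕ → List β) :
    (List.range ((W + 2) * m + 4)).flatMap g = g 0 ++ (g 1 ++ (g 2 ++ (g 3 ++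
      (((List.finRange m).flatMap fun s : Fin m => g (cell m 0 s)) ++
      (((List.range W).flatMap fun j => (List.finRange m).flatMap fun s : Fin m =>
        g (cell m (j + 1) s)) ++
      ((List.finRange m).flatMap fun s : Fin m => g (cell m (W + 1) s))))))) := by
  rw [Nat.add_comm _ 4, List.range_add, show List.range 4 = [0, 1, 2, 3] from rfl,
    List.flatMap_append, List.flatMap_map, flatMap_range_mul, List.range_succ, List.flatMap_append,
    List.flatMap_singleton, List.range_succ_eq_map]
  simp only [List.flatMap_cons, List.flatMap_map, List.flatMap_nil, List.append_nil, List.append_assoc, cell,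
    Nat.add_comm 4, Nat.succ_eq_add_one]

theorem encode_toAFA : (C.toAFA target y).encode =
    [sizeTemplate, C.flagTemplate, initTemplate target, C.cellTemplate].flatMap
      (RowTemplate.expand y) := by
  classical
  set W := y.length with hW
  have hsize : RowTemplate.expand y sizeTemplate =
      encodeNumber 1 ++ encodeNumber ((W + 2) * m + 4) := by
    rw [RowTemplate.expand, sizeTemplate, expand_numberTokens,
      show shift m y.length (true, 2 * m + 4) = (W + 2) * m + 4 by simp only [shift]; ring]
    simp [TemplateToken.expand, encodeNumber]
  have hflags : RowTemplate.expand y C.flagTemplate = encodeNumber 0 ++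
      (List.range ((W + 2) * m + 4)).flatMap
        fun k => if C.IsFinal y k then [yes] else [no] := by
    -- Outside the pass there is no current cell, and the default `C.blank` is exactly the content
    -- of the boundary cells.
    have hcell (i j : ℕ) (a : Option (Fin m)) (h : a.getD C.blank = C.initial y i) :
        C.flagTokens.flatMap (TemplateToken.expand j a) = (List.finRange m).flatMap
          fun s : Fin m => if C.IsFinal y (cell m i s) then [yes] else [no] := by
      rw [flagTokens, List.flatMap_map]
      refine List.flatMap_congr fun s _ => ?_
      simp only [TemplateToken.expand, h, cell, IsFinal, cell_div, cell_mod, ← Fin.ext_iff]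
      split_ifs <;> rfl
    have hbody : y.zipIdx.flatMap (fun c => C.flagTokens.flatMap
        (TemplateToken.expand c.2 (some c.1))) = y.zipIdx.flatMap fun c => (List.finRange m).flatMap
          fun s : Fin m => if C.IsFinal y (cell m (c.2 + 1) s) then [yes] else [no] := by
      refine List.flatMap_congr fun c hc => hcell (c.2 + 1) c.2 (some c.1) ?_
      obtain ⟨a, j⟩ := c
      rw [initial, List.mk_mem_zipIdx_iff_getElem?.1 hc]
    rw [flatMap_states, ← flatMap_zipIdx_snd, RowTemplate.expand, flagTemplate, hbody,
      List.flatMap_append, hcell 0 0 none rfl,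
      hcell (W + 1) y.length none (by rw [initial, List.getElem?_eq_none hW.le])]
    simp [TemplateToken.expand, encodeNumber, IsFinal]
  have htrans : RowTemplate.expand y (initTemplate target) ++ RowTemplate.expand y C.cellTemplate =
      (List.range ((W + 2) * m + 4)).flatMap fun k => encodeNat (C.trans target y k) := by
    -- The entry with `j` predecessors is cell `j + 1`, whose neighbourhood starts at cell `j`: the
    -- relative cells `0`, `1`, `2` are shifted by `j`.
    have hsteps (j : ℕ) (hj : j < W) (a : Option (Fin m)) :
        C.cellTemplate.body.flatMap (TemplateToken.expand j a) = (List.finRange m).flatMap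
          fun s : Fin m => encodeNat (C.trans target y (cell m (j + 1) s)) := by
      rw [cellTemplate, List.flatMap_assoc]
      refine List.flatMap_congr fun s _ => ?_
      rw [expand_formulaTokens, trans_cell, if_neg (by omega), Nat.add_sub_cancel]
    have hboundary (i j : ℕ) (b : Bool) (k : ℕ) (hi : i = 0 ∨ W < i)
        (hk : ∀ s : Fin m, shift m j (b, cell m k s) = cell m i s) :
        ((List.finRange m).flatMap fun s : Fin m => numberTokens (b, cell m k s)).flatMap
          (TemplateToken.expand j (none : Option (Fin m))) = (List.finRange m).flatMap
          fun s : Fin m => encodeNat (C.trans target y (cell m i s)) := by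
      rw [List.flatMap_assoc]
      refine List.flatMap_congr fun s _ => ?_
      rw [expand_numberTokens, trans_cell, if_pos hi, hk]
      rfl
    -- The long disjunction mentions every cell and so takes a pass of its own. In prefix notation
    -- each disjunct is preceded by its own symbol, and the closing atom `3` is left for `post`.
    have hinit : encodeNat (C.trans target y 0) = conj ::
        (y.zipIdx.flatMap (fun c => (initTemplate target).body.flatMap
          (TemplateToken.expand c.2 (some c.1))) ++ (encodeNumber 3 ++
          encodeNat (.or (.atom 1) (.atom 2)))) := by
      rw [trans, encodeNat, encodeNat_disj, List.flatMap_assoc, ← flatMap_zipIdx_snd]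
      rw [List.append_assoc]
      congr 2
      refine List.flatMap_congr fun c _ => ?_
      rw [List.flatMap_map, initTemplate, List.flatMap_assoc]
      refine List.flatMap_congr fun s _ => ?_
      rw [List.flatMap_cons, expand_numberTokens, shift_cell]
      rfl
    -- Both boundaries are written after a pass, when `y.length` cells precede: the left one needs
    -- absolute numbers, while for the right one relative cell `1` is cell `W + 1`.
    rw [flatMap_states, hinit, ← flatMap_zipIdx_snd, ← hboundary 0 y.length false 0 (Or.inl rfl)
      (fun s => rfl), ← hboundary (W + 1) y.length true 1 (Or.inr (by omega))
      (fun s => shift_cell _ _ _)]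
    have hbody : (y.zipIdx.flatMap fun c => (List.finRange m).flatMap
        fun s : Fin m => encodeNat (C.trans target y (cell m (c.2 + 1) s))) =
        y.zipIdx.flatMap fun c => C.cellTemplate.body.flatMap
          (TemplateToken.expand c.2 (some c.1)) := by
      refine List.flatMap_congr fun c hc => (hsteps c.2 ?_ (some c.1)).symm
      have := List.mem_zipIdx hc
      omega
    rw [hbody, RowTemplate.expand, RowTemplate.expand]
    simp only [initTemplate, cellTemplate, List.flatMap_append, expand_formulaTokens]
    simp [TemplateToken.expand, PosFormula.map, shift, encodeNat, trans]
  have henc1 : ((List.finRange ((W + 2) * m + 4)).flatMap fun q =>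
      if q ∈ (C.automaton target y).final then [yes] else [no]) =
      (List.range ((W + 2) * m + 4)).flatMap fun k => if C.IsFinal y k then [yes] else [no] := by
    rw [← flatMap_finRange]
    refine List.flatMap_congr fun q _ => ?_
    simp [automaton]
  have henc2 : ((List.finRange ((W + 2) * m + 4)).flatMap fun q =>
      (List.finRange 1).flatMap fun a => encodeFormula ((C.automaton target y).δ q a)) =
      (List.range ((W + 2) * m + 4)).flatMap fun k => encodeNat (C.trans target y k) := by
    rw [← flatMap_finRange]
    refine List.flatMap_congr fun q _ => ?_
    rw [← encodeFormula_map_ofNat (C.all_trans target y q.2)]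
    simp [automaton, List.finRange_succ]
  simp only [List.flatMap_cons, List.flatMap_nil, List.append_nil]
  rw [htrans, hflags, hsize, ← henc1, ← henc2]
  simp only [encode, toAFA, List.append_assoc]
  rfl

end CellAutomaton

theorem mainTheorem9 :
    IsPSPACEHard AFAInstance.encoding (fun A : AFAInstance => A.aut.IsExistsGFG) := by
  intro I _ L hL
  obtain ⟨m, C, target, blank, star, e, k, d, hC, h⟩ := hL.exists_cellAutomaton
  have : Inhabited AFASymbol := ⟨.tick⟩
  refine ⟨fun x => C.toAFA target (paddedRow blank star (k * (x.length + 1) ^ d) (x.map e)), ?_, ?_⟩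
  · exact RowTemplate.polyTimeComputable blank star e k d _ fun x => C.encode_toAFA target _
  · exact fun x => (h x _ rfl).trans (C.isExistsGFG_automaton_iff target _ hC).symm
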